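/- Let $L$ be a first-order language with a symbol for an order, and let $T$ be an o-minimal $L$-theory, that is, the complete theory of an infinite, densely (linearly) ordered o-minimal $L$-structure (every subset of the structure definable with parameters is a finite union of points and open intervals with endpoints in the structure or $\pm\infty$). Let $L_H=L\cup\{H\}$ with $H$ a new unary predicate, and let $T^{\mathrm{indep}}$ be the $L_H$-theory consisting of $T$ and the following axioms, for all $n,m,k\in\mathbb N$ and all $L$-formulas $\varphi(\bar x,x)$, $\psi$ with $\bar x=(x_1,\dots,x_n)$, $\bar y=(y_1,\dots,y_m)$ (where $\exists^\infty$, "there are infinitely many", is expressed by $\exists^{\ge N}$ for an $N$, depending on the formula, such that modulo $T$ the existence of $N$ solutions implies the existence of infinitely many): 1. Independence: $(\forall x_1,\dots,x_n,x\in H)\big(\bigwedge_{i} x\ne x_i\wedge \exists^{<k}x\,\psi(\bar x,x)\to\neg\psi(\bar x,x)\big)$. 2. Density: $\forall\bar x\,\big(\exists^\infty x\,\varphi(\bar x,x)\to(\exists x\in H)\,\varphi(\bar x,x)\big)$. 3. Extension: $\forall\bar x\,\big(\forall\bar y\,\exists^{<k}x\,\psi(\bar x,\bar y,x)\wedge\exists^\infty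 x\,\varphi(\bar x,x)\to\exists x(\varphi(\bar x,x)\wedge(\forall y_1,\dots,y_m\in H)\,\neg\psi(\bar x,\bar y,x))\big)$. Let $(\mathfrak C,\mathcal H)$ be the monster model of $T^{\mathrm{indep}}$: a model whose cardinality $\lambda$ is a strongly inaccessible cardinal larger than $|L|$, and which realizes all complete $L_H$-types over all small subsets; a set is small if its cardinality is less than $\lambda$. Suppose that there are finitely many $0$-definable functions $f_1,\dots,f_k:\mathfrak C\to\mathfrak C$ (definable in $L$ without parameters) such that for every set $A\subseteq\mathfrak C$ $$\operatorname{dcl}(A)=f_1(A)\cup\dots\cup f_k(A)\cup\operatorname{dcl}(\emptyset),$$ where $\operatorname{dcl}$ is definable closure in the $L$-structure $\mathfrak C$. Put $o(\mathcal H)=\{\mathcal H'\subseteq\mathfrak C\mid(\mathfrak C,\mathcal H)\cong(\mathfrak C,\mathcal H')\}$ and $e(\mathcal H)=\{\mathcal H'\subseteq\mathfrak C\mid(\mathfrak C,\mathcal H)\equiv(\mathfrak C,\mathcal H')\}$ (isomorphism and elementary equivalence of $L_H$-structures). Then $$o(\mathcal H)=e(\mathcal H).$$ Moreover, every $\mathcal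 H'\subseteq\mathfrak C$ with $(\mathfrak C,\mathcal H')\equiv(\mathfrak C,\mathcal H)$ has the following two properties, for every small $B\subseteq\mathfrak C$ and every non-algebraic $L$-type $p(x)\in S_1(B)$: (density) $p$ has a realization in $\mathcal H'$; (extension) $p$ has a realization $b\in\mathfrak C$ with $b\notin\operatorname{acl}(B\cup\mathcal H')$. Consequently $(\mathfrak C,\mathcal H)\cong(\mathfrak C,\mathcal H')$. -/

import Mathlib

open FirstOrder FirstOrder.Language Cardinal

universe u v w w'

namespace OrbitElem

section Geometry

variable (L : FirstOrder.Language.{u, v}) {M : Type w} [L.Structure M]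

/-- Definable closure: `a ∈ dcl(A)` iff `{a}` is definable with parameters from `A`. -/
def dcl (A : Set M) : Set M := {a | A.Definable₁ L {a}}

/-- Algebraic closure: `a ∈ acl(A)` iff `a` lies in a finite set definable with parameters
from `A`. -/
def acl (A : Set M) : Set M := {a | ∃ X : Set M, X.Finite ∧ A.Definable₁ L X ∧ a ∈ X}

/-- A unary function on `M` is `0`-definable if its graph is definable without parameters. -/
def ZeroDefinable (f : M → M) : Prop := (∅ : Set M).Definable₂ L {x : M × M | f x.1 = x.2}

end Geometry

section OMinimal

/-- Points and open intervals with endpoints in `M ∪ {-∞, +∞}`. -/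
def IsPointOrInterval {M : Type w} [LinearOrder M] (s : Set M) : Prop :=
  (∃ a, s = {a}) ∨ (∃ a b, s = Set.Ioo a b) ∨ (∃ a, s = Set.Iio a) ∨ (∃ a, s = Set.Ioi a) ∨
    s = Set.univ

/-- An ordered structure is o-minimal if each subset of `M` definable with parameters is a finite
union of points and intervals. -/
def IsOMinimal (L : FirstOrder.Language.{u, v}) (M : Type w) [LinearOrder M] [L.Structure M] : Prop :=
  ∀ s : Set M, (Set.univ : Set M).Definable₁ L s →
    ∃ F : Set (Set M), F.Finite ∧ (∀ t ∈ F, IsPointOrInterval t) ∧ s = ⋃₀ F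

end OMinimal

section Monster

/-- `S₁(A)`: complete `1`-types, in the sense of the `L`-structure `M`, with parameters from
`A`. -/
abbrev TypesOver (L : FirstOrder.Language.{u, v}) {M : Type w} [L.Structure M] (A : Set M) :=
  (L[[A]].completeTheory M).CompleteType (Fin 1)

/-- The element `a` realizes the complete type `p` over `A`. -/
def Realizes {L : FirstOrder.Language.{u, v}} {M : Type w} [L.Structure M] [Nonempty M] {A : Set M}
    (a : M) (p : TypesOver L A) : Prop :=
  (L[[A]].completeTheory M).typeOf (fun _ : Fin 1 => a) = p

/-- A type over `A` is non-algebraic if each of its formulas has infinitely many solutions. -/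
def NonAlgebraic {L : FirstOrder.Language.{u, v}} {M : Type w} [L.Structure M] {A : Set M}
    (p : TypesOver L A) : Prop :=
  ∀ φ : L[[A]].Formula (Fin 1), Formula.equivSentence φ ∈ p →
    {a : M | φ.Realize (fun _ => a)}.Infinite

/-- `M` is a monster model of its theory: its cardinality is a strongly inaccessible cardinal
above the size of the language, and it realizes all types over all small subsets, small meaning of
cardinality less than that of `M`. -/
structure IsMonster (L : FirstOrder.Language.{u, v}) (M : Type w) [L.Structure M] [Nonempty M] : Prop where
  inaccessible : (#M).IsInaccessible
  card_language_lt : lift.{w} L.card < lift.{max u v} #M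
  saturated : ∀ A : Set M, #A < #M → ∀ p : TypesOver L A, ∃ a : M, Realizes a p

end Monster

section Predicate

/-- The relation symbols of the language with a single unary predicate `H`. -/
inductive PredRel : ℕ → Type
  | H : PredRel 1

/-- The language with a single unary predicate. -/
def predLanguage : FirstOrder.Language.{0, 0} := ⟨fun _ => Empty, PredRel⟩

/-- The language `L_H = L ∪ {H}`. -/
abbrev withH (L : FirstOrder.Language.{u, v}) : FirstOrder.Language.{u, v} := L.sum predLanguage

/-- The symbol `H` of `L_H`. -/
def symbH (L : FirstOrder.Language.{u, v}) : (withH L).Relations 1 :=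
  (Sum.inr (PredRel.H : predLanguage.Relations 1) : L.Relations 1 ⊕ predLanguage.Relations 1)

/-- The expansion `(M, H)` of the structure `M`: the same universe, the same interpretation of the
symbols of `L`, and the new predicate interpreted by the set `H`. -/
def Expansion (M : Type w) (_H : Set M) : Type w := M

variable {L : FirstOrder.Language.{u, v}} {M : Type w}

instance [L.Structure M] (H : Set M) : L.Structure (Expansion M H) :=
  inferInstanceAs (L.Structure M)

instance [Nonempty M] (H : Set M) : Nonempty (Expansion M H) :=
  inferInstanceAs (Nonempty M)

instance (H : Set M) : predLanguage.Structure (Expansion M H) where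
  funMap := fun f => nomatch f
  RelMap := fun
    | .H => fun x => x 0 ∈ H

/-- `e(H)`, the elementary class of `H`: all `H'` with `(M, H) ≡ (M, H')`. -/
def elemClass (L : FirstOrder.Language.{u, v}) {M : Type w} [L.Structure M] (H : Set M) : Set (Set M) :=
  {H' | Expansion M H ≅[withH L] Expansion M H'}

/-- `o(H)`, the orbit of `H`: all `H'` with `(M, H) ≅ (M, H')`. -/
def orbit (L : FirstOrder.Language.{u, v}) {M : Type w} [L.Structure M] (H : Set M) : Set (Set M) :=
  {H' | Nonempty (Expansion M H ≃[withH L] Expansion M H')}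

/-- Density over small sets: if `B` is small, each non-algebraic `L`-type over `B` has a
realization in `H`. -/
def DensityOverSmall (L : FirstOrder.Language.{u, v}) {M : Type w} [L.Structure M] [Nonempty M]
    (H : Set M) : Prop :=
  ∀ B : Set M, #B < #M → ∀ p : TypesOver L B, NonAlgebraic p → ∃ a ∈ H, Realizes a p

/-- Extension over small sets: if `B` is small, each non-algebraic `L`-type over `B` has a
realization outside `acl(B ∪ H)`. -/
def ExtensionOverSmall (L : FirstOrder.Language.{u, v}) {M : Type w} [L.Structure M] [Nonempty M]
    (H : Set M) : Prop :=
  ∀ B : Set M, #B < #M → ∀ p : TypesOver L B, NonAlgebraic p →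
    ∃ a : M, Realizes a p ∧ a ∉ acl L (B ∪ H)

end Predicate

section Theories

variable {L : FirstOrder.Language.{u, v}}

/-- The formula `∃^{≥ k} x φ(y, x)` in the variables `y`. -/
noncomputable def atLeast {α : Type} (k : ℕ) (φ : L.Formula (α ⊕ Unit)) : L.Formula α :=
  Formula.iExs (Fin k)
    (Formula.iInf (fun i : Fin k => Formula.relabel (Sum.map id (fun _ => i)) φ) ⊓
      Formula.iInf (fun ij : {ij : Fin k × Fin k // ij.1 ≠ ij.2} =>
        ∼((Term.var (Sum.inr ij.1.1)).equal (Term.var (Sum.inr ij.1.2)))))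

/-- The formula `∃^{< k} x φ(y, x)` in the variables `y`. -/
noncomputable def fewerThan {α : Type} (k : ℕ) (φ : L.Formula (α ⊕ Unit)) : L.Formula α :=
  ∼(atLeast k φ)

/-- The number `N` eliminates `∃^∞` for `φ(y, x)` modulo `T`: whenever there are at least `N`
elements `x` with `φ(y, x)`, there are infinitely many. So `∃^{≥ N} x φ(y, x)` is then a
first-order expression, modulo `T`, of `∃^∞ x φ(y, x)`. -/
def Eliminates (T : L.Theory) {α : Type} (N : ℕ) (φ : L.Formula (α ⊕ Unit)) : Prop :=
  ∀ m : ℕ, T ⊨ᵇ (atLeast N φ).imp (atLeast m φ)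

/-- The universal closure of a formula. -/
noncomputable def univClosure {α : Type} [Finite α] (φ : L.Formula α) : L.Sentence :=
  Formula.iAlls α (Formula.relabel Sum.inr φ)

/-- An `L`-formula as a formula of `L_H`. -/
def up {α : Type} (φ : L.Formula α) : (withH L).Formula α :=
  (LHom.sumInl : L →ᴸ withH L).onFormula φ

/-- The atomic formula `H(x)`. -/
def inH {α : Type} (x : α) : (withH L).Formula α :=
  Relations.formula₁ (symbH L) (Term.var x)

/-- Independence axiom: for all `x₁, …, xₙ, x` in `H`, if `x ≠ xᵢ` for all `i` and
`∃^{< k} x ψ(x₁, …, xₙ, x)`, then `¬ψ(x₁, …, xₙ, x)`. -/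
noncomputable def independenceAxiom (n k : ℕ) (ψ : L.Formula (Fin n ⊕ Unit)) :
    (withH L).Sentence :=
  univClosure (α := Fin n ⊕ Unit)
    ((Formula.iInf (fun i : Fin n => inH (Sum.inl i)) ⊓ inH (Sum.inr ()) ⊓
        Formula.iInf (fun i : Fin n =>
          ∼((Term.var (Sum.inr ())).equal (Term.var (Sum.inl i)))) ⊓
        Formula.relabel Sum.inl (up (fewerThan k ψ))).imp
      (∼(up ψ)))

/-- Density axiom: for all `x₁, …, xₙ`, if `∃^∞ x φ(x₁, …, xₙ, x)`, written as
`∃^{≥ N} x φ(x₁, …, xₙ, x)`, then there is `x` in `H` with `φ(x₁, …, xₙ, x)`. -/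
noncomputable def densityAxiom (n N : ℕ) (φ : L.Formula (Fin n ⊕ Unit)) : (withH L).Sentence :=
  univClosure (α := Fin n)
    ((up (atLeast N φ)).imp (Formula.iExs Unit (inH (Sum.inr ()) ⊓ up φ)))

/-- Extension axiom: for all `x₁, …, xₙ`, if `∃^{< k} x ψ(x₁, …, xₙ, y₁, …, yₘ, x)` for all
`y₁, …, yₘ` and `∃^∞ x φ(x₁, …, xₙ, x)`, written as `∃^{≥ N} x φ(x₁, …, xₙ, x)`, then there is `x`
with `φ(x₁, …, xₙ, x)` and with `¬ψ(x₁, …, xₙ, y₁, …, yₘ, x)` for all `y₁, …, yₘ` in `H`. -/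
noncomputable def extensionAxiom (n m k N : ℕ) (φ : L.Formula (Fin n ⊕ Unit))
    (ψ : L.Formula ((Fin n ⊕ Fin m) ⊕ Unit)) : (withH L).Sentence :=
  univClosure (α := Fin n)
    ((up (Formula.iAlls (Fin m) (fewerThan k ψ)) ⊓ up (atLeast N φ)).imp
      (Formula.iExs Unit
        (up φ ⊓
          Formula.iAlls (Fin m)
            ((Formula.iInf (fun j : Fin m => inH (Sum.inr j))).imp
              (∼(Formula.relabel
                (Sum.elim (Sum.elim (fun i => Sum.inl (Sum.inl i)) (fun j => Sum.inr j))
                  (fun _ => Sum.inl (Sum.inr ())))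
                (up ψ)))))))

/-- The theory `T^indep` in the language `L_H`: the theory `T` together with the axioms saying that
`H` is independent, and the density and extension axioms. -/
def Tindep (T : L.Theory) : (withH L).Theory :=
  (LHom.sumInl : L →ᴸ withH L).onTheory T ∪
    {σ | ∃ (n k : ℕ) (ψ : L.Formula (Fin n ⊕ Unit)), σ = independenceAxiom n k ψ} ∪
    {σ | ∃ (n N : ℕ) (φ : L.Formula (Fin n ⊕ Unit)), Eliminates T N φ ∧
      σ = densityAxiom n N φ} ∪
    {σ | ∃ (n m k N : ℕ) (φ : L.Formula (Fin n ⊕ Unit)) (ψ : L.Formula ((Fin n ⊕ Fin m) ⊕ Unit)),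
      Eliminates T N φ ∧ σ = extensionAxiom n m k N φ ψ}

end Theories

end OrbitElem

/-! An isomorphism preserves all sentences, so `orbit` is contained in `elemClass`. For the converse
let `H'` have the same `L_H`-theory as `H`. Then `H'` satisfies the axioms of `Tindep`, but the
expansion by `H'` is not known to be saturated; only the `L`-structure is. The point is that, when
definable closure is given by finitely many unary functions, single instances of the axioms already
yield density and extension over all small sets.

Let `A` be small and `c ∉ dcl(A)`. By saturation the type of `c` over `A` has a second realization
`d`, and every point between `c` and `d` realizes it too: the boundary of an `A`-definable set is
finite, hence lies in `dcl(A)`, and no point of `dcl(A)` separates `c` from `d` (`bd_finite`,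
`typeEq_of_between`, `exists_typeEq_Ioo`). So the type contains an open interval. The density axiom
for `y₀ < x < y₁` puts a point of `H'` into it. The extension axiom for the same formula, with `x =
fᵢ(y)` for some `i` as the formula to avoid, puts a point outside all `fᵢ(H')` into it; as `dcl(A ∪
H')` is the union of the `fᵢ(A)`, the `fᵢ(H')` and `dcl(∅)`, this point is not in `dcl(A ∪ H')`.

With these two properties and exchange (`exchange_apply`), a back-and-forth of length `#M` through
small elementary relations (`GoodRel`, `forth`, `back`) builds an automorphism of the `L`-structure
that maps `H` onto `H'`. O-minimality enters only through two first-order consequences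
(`LocallyOMinimal`), which pass from the given o-minimal model to the monster. -/

namespace OrbitElem

/-! ### Predicates given by one formula, and definability over parameters. -/

section Corresponding

variable {L : FirstOrder.Language.{u, v}}

/-- Two predicates on two structures are corresponding if one formula defines both of them. -/
def Corr (L : FirstOrder.Language.{u, v}) {α : Type*} {M : Type*} {N : Type*} [L.Structure M]
    [L.Structure N] (P : (α → M) → Prop) (Q : (α → N) → Prop) : Prop :=
  ∃ φ : L.Formula α, (∀ v, φ.Realize v ↔ P v) ∧ ∀ v, φ.Realize v ↔ Q v

namespace Corr

variable {α β : Type*} {M : Type*} {N : Type*} [L.Structure M] [L.Structure N]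
  {P P' : (α → M) → Prop} {Q Q' : (α → N) → Prop}

/-- The closure rules let a proof follow the shape of a predicate. Used with one structure and the
language `L[[A]]` they give definability over `A`; used with two elementarily equivalent structures
they give transfer. -/
theorem and (h : Corr L P Q) (h' : Corr L P' Q') :
    Corr L (fun v => P v ∧ P' v) (fun v => Q v ∧ Q' v) := by
  obtain ⟨φ, h1, h2⟩ := h
  obtain ⟨ψ, h3, h4⟩ := h'
  exact ⟨φ ⊓ ψ, by simp [h1, h3], by simp [h2, h4]⟩

theorem not (h : Corr L P Q) : Corr L (fun v => ¬ P v) (fun v => ¬ Q v) := by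
  obtain ⟨φ, h1, h2⟩ := h
  exact ⟨∼φ, by simp [h1], by simp [h2]⟩

theorem congr (h : Corr L P Q) (hP : ∀ v, P v ↔ P' v) (hQ : ∀ v, Q v ↔ Q' v) :
    Corr L P' Q' := by
  obtain ⟨φ, h1, h2⟩ := h
  exact ⟨φ, fun v => (h1 v).trans (hP v), fun v => (h2 v).trans (hQ v)⟩

theorem or (h : Corr L P Q) (h' : Corr L P' Q') :
    Corr L (fun v => P v ∨ P' v) (fun v => Q v ∨ Q' v) :=
  (h.not.and h'.not).not.congr (fun v => by tauto) (fun v => by tauto)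

theorem imp (h : Corr L P Q) (h' : Corr L P' Q') :
    Corr L (fun v => P v → P' v) (fun v => Q v → Q' v) :=
  (h.and h'.not).not.congr (fun v => by tauto) (fun v => by tauto)

theorem iff (h : Corr L P Q) (h' : Corr L P' Q') :
    Corr L (fun v => P v ↔ P' v) (fun v => Q v ↔ Q' v) :=
  ((h.imp h').and (h'.imp h)).congr (fun v => by tauto) (fun v => by tauto)

theorem comp (h : Corr L P Q) (e : α → β) :
    Corr L (fun v : β → M => P (v ∘ e)) (fun v : β → N => Q (v ∘ e)) := by
  obtain ⟨φ, h1, h2⟩ := h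
  exact ⟨φ.relabel e, fun v => by simp [h1], fun v => by simp [h2]⟩

theorem ex {P : (α → M) → M → Prop} {Q : (α → N) → N → Prop}
    (h : Corr L (fun v : α ⊕ Unit → M => P (fun a => v (Sum.inl a)) (v (Sum.inr ())))
      (fun v : α ⊕ Unit → N => Q (fun a => v (Sum.inl a)) (v (Sum.inr ())))) :
    Corr L (fun v => ∃ x, P v x) (fun v => ∃ x, Q v x) := by
  obtain ⟨φ, h1, h2⟩ := h
  refine ⟨φ.iExs Unit, fun v => ?_, fun v => ?_⟩
  · simp only [Formula.realize_iExs, h1]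
    exact ⟨fun ⟨i, hi⟩ => ⟨i (), hi⟩, fun ⟨x, hx⟩ => ⟨fun _ => x, hx⟩⟩
  · simp only [Formula.realize_iExs, h2]
    exact ⟨fun ⟨i, hi⟩ => ⟨i (), hi⟩, fun ⟨x, hx⟩ => ⟨fun _ => x, hx⟩⟩

theorem all {P : (α → M) → M → Prop} {Q : (α → N) → N → Prop}
    (h : Corr L (fun v : α ⊕ Unit → M => P (fun a => v (Sum.inl a)) (v (Sum.inr ())))
      (fun v : α ⊕ Unit → N => Q (fun a => v (Sum.inl a)) (v (Sum.inr ())))) :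
    Corr L (fun v => ∀ x, P v x) (fun v => ∀ x, Q v x) :=
  (ex (P := fun v x => ¬ P v x) (Q := fun v x => ¬ Q v x) h.not).not.congr
    (fun v => by simp) (fun v => by simp)

theorem le [L.IsOrdered] [LE M] [L.OrderedStructure M] [LE N] [L.OrderedStructure N]
    (i j : α) : Corr L (fun v : α → M => v i ≤ v j) (fun v : α → N => v i ≤ v j) := by
  refine ⟨Relations.formula₂ leSymb (Term.var i) (Term.var j), ?_, ?_⟩ <;>
  · intro v
    rw [Formula.realize_rel₂, relMap_leSymb]
    simp

theorem lt [L.IsOrdered] [LinearOrder M] [L.OrderedStructure M] [LinearOrder N]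
    [L.OrderedStructure N]
    (i j : α) : Corr L (fun v : α → M => v i < v j) (fun v : α → N => v i < v j) :=
  (le j i).not.congr (fun v => by simp) (fun v => by simp)

theorem transfer [Finite α] (h : Corr L P Q) (hMN : M ≅[L] N) (hP : ∀ v, P v) (v : α → N) :
    Q v := by
  obtain ⟨φ, h1, h2⟩ := h
  have key : M ⊨ Formula.iAlls α (Formula.relabel (Sum.inr : α → Empty ⊕ α) φ) := by
    simp only [Sentence.Realize, Formula.realize_iAlls, Formula.realize_relabel]
    exact fun i => (h1 _).2 (hP _)
  rw [hMN.realize_sentence] at key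
  simp only [Sentence.Realize, Formula.realize_iAlls, Formula.realize_relabel] at key
  exact (h2 _).1 (key v)

end Corr

variable {M : Type w} [L.Structure M] {A B : Set M}

instance [L.IsOrdered] {α : Type*} : L[[α]].IsOrdered :=
  ⟨Sum.inl leSymb⟩

instance [L.IsOrdered] [LE M] [L.OrderedStructure M] : L[[A]].OrderedStructure M where
  relMap_leSymb x := relMap_leSymb (L := L) x

/-- A predicate on tuples is definable over `A`. -/
abbrev DefPred (L : FirstOrder.Language.{u, v}) {α : Type*} {M : Type w} [L.Structure M]
    (A : Set M) (P : (α → M) → Prop) : Prop := Corr L[[A]] P P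

theorem defPred_iff {α : Type*} {P : (α → M) → Prop} :
    DefPred L A P ↔ A.Definable L {v | P v} := by
  constructor
  · rintro ⟨φ, h, -⟩
    exact ⟨φ, by ext v; exact (h v).symm⟩
  · rintro ⟨φ, h⟩
    have : ∀ v, φ.Realize v ↔ P v := fun v => (Set.ext_iff.1 h v).symm
    exact ⟨φ, this, this⟩

theorem DefPred.mono {α : Type*} {P : (α → M) → Prop} (h : DefPred L A P) (hAB : A ⊆ B) :
    DefPred L B P := defPred_iff.2 ((defPred_iff.1 h).mono hAB)

theorem definable₁_iff {X : Set M} :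
    A.Definable₁ L X ↔ DefPred L A (fun v : Unit → M => v () ∈ X) := by
  rw [defPred_iff]
  constructor
  · intro h
    exact Set.Definable.preimage_comp (fun _ : Fin 1 => ()) h
  · intro h
    exact Set.Definable.preimage_comp (fun _ : Unit => (0 : Fin 1)) h

theorem definable₁_mem {X : Set M} (h : A.Definable₁ L X) {α : Type*} (i : α) :
    DefPred L A (fun v : α → M => v i ∈ X) :=
  (definable₁_iff.1 h).comp (fun _ => i)

/-- Substitution of an element of `A` for a variable. -/
theorem DefPred.subst {α : Type*} {P : (α → M) → M → Prop} {a : M} (ha : a ∈ dcl L A)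
    (h : DefPred L A (fun v : α ⊕ Unit → M => P (fun i => v (Sum.inl i)) (v (Sum.inr ())))) :
    DefPred L A (fun v => P v a) := by
  have := Corr.ex (P := fun v x => x ∈ ({a} : Set M) ∧ P v x)
    (Q := fun v x => x ∈ ({a} : Set M) ∧ P v x)
    ((definable₁_mem ha (Sum.inr ())).and h)
  exact this.congr (by simp) (by simp)

theorem subset_dcl : A ⊆ dcl L A := fun _ ha => Set.Definable.singleton_of_mem (L := L) ha

theorem dcl_mono (h : A ⊆ B) : dcl L A ⊆ dcl L B := fun _ ha => Set.Definable.mono ha h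

theorem dcl_subset_acl : dcl L A ⊆ acl L A := fun a ha => ⟨{a}, Set.finite_singleton a, ha, rfl⟩

/-- The parameter `a` is turned into an additional variable; parameters already in `A` stay
parameters. -/
theorem DefPred.exists_insert {α : Type*} {P : (α → M) → Prop} {a : M}
    (h : DefPred L (insert a A) P) :
    ∃ Q : (α ⊕ Unit → M) → Prop, DefPred L A Q ∧ ∀ v, P v ↔ Q (Sum.elim v (fun _ => a)) := by
  classical
  rw [defPred_iff, Set.definable_iff_exists_formula_sum] at h
  obtain ⟨φ, hφ⟩ := h
  let e : (insert a A : Set M) ⊕ α → A ⊕ (α ⊕ Unit) :=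
    Sum.elim (fun i => if hi : (i : M) ∈ A then Sum.inl ⟨i, hi⟩ else Sum.inr (Sum.inr ()))
      (fun i => Sum.inr (Sum.inl i))
  refine ⟨fun v => (φ.relabel e).Realize (Sum.elim (↑) v), ?_, fun v => ?_⟩
  · rw [defPred_iff, Set.definable_iff_exists_formula_sum]
    exact ⟨φ.relabel e, rfl⟩
  · have := Set.ext_iff.1 hφ v
    simp only [Set.mem_ofPred_eq] at this
    simp only [this, Formula.realize_relabel]
    apply iff_of_eq
    congr 1
    funext i
    rcases i with ⟨i, hi⟩ | i
    · by_cases hA : i ∈ A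
      · simp [e, hA]
      · have : i = a := by simpa [hA] using hi
        subst this
        simp [e, hA]
    · simp [e]

theorem DefPred.of_insert {α : Type*} {P : (α → M) → Prop} {a : M} (ha : a ∈ dcl L A)
    (h : DefPred L (insert a A) P) : DefPred L A P := by
  obtain ⟨Q, hQ, hPQ⟩ := h.exists_insert
  have := DefPred.subst (P := fun v x => Q (Sum.elim v (fun _ => x))) ha
    (hQ.congr (fun v => iff_of_eq (by congr 1; funext i; rcases i with i | i <;> rfl))
      (fun v => iff_of_eq (by congr 1; funext i; rcases i with i | i <;> rfl)))
  exact this.congr (fun v => (hPQ v).symm) (fun v => (hPQ v).symm)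

theorem dcl_insert_of_mem {a : M} (ha : a ∈ dcl L A) : dcl L (insert a A) = dcl L A := by
  refine Set.Subset.antisymm (fun b hb => ?_) (dcl_mono (Set.subset_insert _ _))
  exact definable₁_iff.2 ((definable₁_iff.1 hb).of_insert ha)

end Corresponding

/-! ### Boundaries of definable sets in a locally o-minimal order. -/

section Boundary

/-- The points of a linear order near which membership in `X` is not constant. -/
def bd {M : Type*} [LinearOrder M] (X : Set M) : Set M :=
  {g | ¬ (((∃ z, g < z) → ∃ y, g < y ∧ ∀ t, g < t ∧ t < y → (t ∈ X ↔ g ∈ X)) ∧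
    ((∃ z, z < g) → ∃ y, y < g ∧ ∀ t, y < t ∧ t < g → (t ∈ X ↔ g ∈ X)))}

/-- Definable completeness and constancy of definable sets to the right of each point: the part of
the first-order content of o-minimality that is used here. -/
structure LocallyOMinimal (L : FirstOrder.Language.{u, v}) (M : Type w) [LinearOrder M]
    [L.Structure M] : Prop where
  exists_isLUB : ∀ X : Set M, (Set.univ : Set M).Definable₁ L X → X.Nonempty → BddAbove X →
    ∃ s, IsLUB X s
  right : ∀ X : Set M, (Set.univ : Set M).Definable₁ L X → ∀ g z : M, g < z →
    ∃ y, g < y ∧ ((∀ t, g < t ∧ t < y → t ∈ X) ∨ ∀ t, g < t ∧ t < y → t ∉ X)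

variable {L : FirstOrder.Language.{u, v}} {M : Type w} [L.Structure M] {A B : Set M}

theorem definable₁_univ {X : Set M} (h : A.Definable₁ L X) : (Set.univ : Set M).Definable₁ L X :=
  Set.Definable.mono h (Set.subset_univ _)

theorem definable₁_compl {X : Set M} (h : A.Definable₁ L X) : A.Definable₁ L Xᶜ :=
  Set.Definable.compl h

theorem definable₁_inter {X Y : Set M} (h : A.Definable₁ L X) (h' : A.Definable₁ L Y) :
    A.Definable₁ L (X ∩ Y) := Set.Definable.inter h h'

theorem definable₁_sInter {F : Set (Set M)} (hF : F.Finite) (h : ∀ X ∈ F, A.Definable₁ L X) :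
    A.Definable₁ L (⋂₀ F) := by
  induction F, hF using Set.Finite.induction_on with
  | empty =>
    rw [Set.sInter_empty]
    exact Set.definable_univ
  | @insert X F hX hF ih =>
    rw [Set.sInter_insert]
    exact definable₁_inter (h X (by simp)) (ih fun Y hY => h Y (by simp [hY]))

variable [LinearOrder M]

theorem bd_compl (X : Set M) : bd Xᶜ = bd X := by
  ext g
  simp only [bd, Set.mem_compl_iff, Set.mem_ofPred_eq, not_iff_not]

theorem corr_bd {N : Type*} [L.Structure N] [LinearOrder N] [L.IsOrdered] [L.OrderedStructure M]
    [L.OrderedStructure N] {α : Type*} {P : (α → M) → Set M} {Q : (α → N) → Set N}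
    (h : Corr L (fun v : α ⊕ Unit → M => v (Sum.inr ()) ∈ P (fun i => v (Sum.inl i)))
      (fun v : α ⊕ Unit → N => v (Sum.inr ()) ∈ Q (fun i => v (Sum.inl i)))) :
    Corr L (fun v : α ⊕ Unit → M => v (Sum.inr ()) ∈ bd (P (fun i => v (Sum.inl i))))
      (fun v : α ⊕ Unit → N => v (Sum.inr ()) ∈ bd (Q (fun i => v (Sum.inl i)))) := by
  have h2 := h.comp (Sum.elim (fun i => Sum.inl (Sum.inl (Sum.inl i))) Sum.inr :
    α ⊕ Unit → ((α ⊕ Unit) ⊕ Unit) ⊕ Unit)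
  have h1 := h.comp (fun i => Sum.inl (Sum.inl i) : α ⊕ Unit → ((α ⊕ Unit) ⊕ Unit) ⊕ Unit)
  refine Corr.not (Corr.and (Corr.imp (Corr.ex ?_) (Corr.ex (Corr.and ?_ (Corr.all (Corr.imp
    (Corr.and ?_ ?_) (Corr.iff ?_ ?_))))))
    (Corr.imp (Corr.ex ?_) (Corr.ex (Corr.and ?_ (Corr.all (Corr.imp
    (Corr.and ?_ ?_) (Corr.iff ?_ ?_)))))))
  · exact Corr.lt _ _
  · exact Corr.lt _ _
  · exact Corr.lt _ _
  · exact Corr.lt _ _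
  · exact h2
  · exact h1
  · exact Corr.lt _ _
  · exact Corr.lt _ _
  · exact Corr.lt _ _
  · exact Corr.lt _ _
  · exact h2
  · exact h1

theorem definable₁_bd [L.IsOrdered] [L.OrderedStructure M] {X : Set M} (h : A.Definable₁ L X) :
    A.Definable₁ L (bd X) := by
  have := corr_bd (L := L[[A]]) (P := fun _ : Empty → M => X) (Q := fun _ : Empty → M => X)
    (definable₁_mem h _)
  exact definable₁_iff.2 (Corr.comp this (fun _ => ()))

namespace LocallyOMinimal

/-- Membership in `X` is constant on an interval to the right of `g`, so boundary points cannot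
accumulate at `g` from the right. -/
theorem bd_right (hM : LocallyOMinimal L M) {X : Set M} (hX : A.Definable₁ L X) {g z : M} (hgz : g < z) :
    ∃ y, g < y ∧ ∀ t, g < t ∧ t < y → t ∉ bd X := by
  obtain ⟨y, hy, h⟩ := hM.right X (definable₁_univ hX) g z hgz
  have h' : ∀ t t', g < t ∧ t < y → g < t' ∧ t' < y → (t ∈ X ↔ t' ∈ X) := fun t t' ht ht' => by
    rcases h with h | h
    · exact iff_of_true (h t ht) (h t' ht')
    · exact iff_of_false (h t ht) (h t' ht')
  refine ⟨y, hy, fun t ht hbd => hbd ⟨fun _ => ⟨y, ht.2, fun t' ht' => ?_⟩,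
    fun _ => ⟨g, ht.1, fun t' ht' => ?_⟩⟩⟩
  · exact h' _ _ ⟨ht.1.trans ht'.1, ht'.2⟩ ht
  · exact h' _ _ ⟨ht'.1, ht'.2.trans ht.2⟩ ht

variable [DenselyOrdered M] [L.IsOrdered] [L.OrderedStructure M]

/-- The supremum of the `x` with `[c, x] ⊆ X` is a boundary point: otherwise it would lie in `X`,
and the segment could be prolonged. -/
theorem exists_mem_bd_aux (hM : LocallyOMinimal L M) {X : Set M} (hX : A.Definable₁ L X) {c e : M} (hce : c < e)
    (hc : c ∈ X) (he : e ∉ X) : ∃ g ∈ bd X, c ≤ g ∧ g ≤ e := by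
  set Y : Set M := {x | c ≤ x ∧ ∀ t, c ≤ t ∧ t ≤ x → t ∈ X} with hY
  have hYd : (Set.univ : Set M).Definable₁ L Y := by
    rw [definable₁_iff]
    have hc' : c ∈ dcl L (Set.univ : Set M) := subset_dcl (Set.mem_univ c)
    refine DefPred.subst (P := fun v c => c ≤ v () ∧ ∀ t, c ≤ t ∧ t ≤ v () → t ∈ X) hc' ?_
    exact (Corr.le _ _).and (Corr.all (((Corr.le _ _).and (Corr.le _ _)).imp
      (definable₁_mem (definable₁_univ hX) _)))
  have hcY : c ∈ Y := ⟨le_rfl, fun t ht => le_antisymm ht.1 ht.2 ▸ hc⟩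
  have hYe : ∀ x ∈ Y, x ≤ e := fun x hx => by
    by_contra h
    exact he (hx.2 e ⟨hce.le, (not_le.1 h).le⟩)
  obtain ⟨s, hs⟩ := hM.exists_isLUB Y hYd ⟨c, hcY⟩ ⟨e, hYe⟩
  refine ⟨s, fun hbd => ?_, hs.1 hcY, hs.2 hYe⟩
  have hlt : ∀ t, c ≤ t → t < s → t ∈ X := fun t h1 h2 => by
    obtain ⟨x, hx, htx⟩ := (lt_isLUB_iff hs).1 h2
    exact hx.2 t ⟨h1, htx.le⟩
  have hsX : s ∈ X := by
    rcases (hs.1 hcY).eq_or_lt with h | h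
    · exact h ▸ hc
    · obtain ⟨y, hy, hy'⟩ := hbd.2 ⟨c, h⟩
      obtain ⟨t, ht, hts⟩ := exists_between (max_lt hy h)
      exact (hy' t ⟨(le_max_left _ _).trans_lt ht, hts⟩).1
        (hlt t ((le_max_right _ _).trans ht.le) hts)
  have hse : s < e := lt_of_le_of_ne (hs.2 hYe) (fun h => he (h ▸ hsX))
  obtain ⟨y, hy, hy'⟩ := hbd.1 ⟨e, hse⟩
  obtain ⟨t, hst, hty⟩ := exists_between hy
  have : t ∈ Y := by
    refine ⟨(hs.1 hcY).trans hst.le, fun t' ht' => ?_⟩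
    rcases lt_trichotomy t' s with h | h | h
    · exact hlt t' ht'.1 h
    · exact h ▸ hsX
    · exact (hy' t' ⟨h, ht'.2.trans_lt hty⟩).2 hsX
  exact absurd (hs.1 this) (not_le.2 hst)

theorem exists_mem_bd (hM : LocallyOMinimal L M) {X : Set M} (hX : A.Definable₁ L X) {c e : M} (hce : c < e)
    (h : ¬ (c ∈ X ↔ e ∈ X)) : ∃ g ∈ bd X, c ≤ g ∧ g ≤ e := by
  by_cases hc : c ∈ X
  · exact hM.exists_mem_bd_aux hX hce hc (by tauto)
  · rw [← bd_compl]
    exact hM.exists_mem_bd_aux (definable₁_compl hX) hce hc (by simp; tauto)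

/-- The next boundary point is the supremum of those `t` for which `(x, t]` misses `bd X`;
`bd_right` makes this set nonempty and shows that its supremum cannot lie outside `bd X`. -/
theorem exists_bd_succ (hM : LocallyOMinimal L M) {X : Set M} (hX : A.Definable₁ L X) {x d : M} (hd : d ∈ bd X) (hxd : x < d) :
    ∃ s ∈ bd X, x < s ∧ ∀ t, x < t ∧ t < s → t ∉ bd X := by
  set W : Set M := {t | x < t ∧ ∀ u, x < u ∧ u ≤ t → u ∉ bd X} with hW
  have hbdd := definable₁_bd (definable₁_univ hX)
  have hWd : (Set.univ : Set M).Definable₁ L W := by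
    rw [definable₁_iff]
    have hx' : x ∈ dcl L (Set.univ : Set M) := subset_dcl (Set.mem_univ x)
    refine DefPred.subst (P := fun v x => x < v () ∧ ∀ u, x < u ∧ u ≤ v () → ¬ u ∈ bd X) hx' ?_
    exact (Corr.lt _ _).and (Corr.all (((Corr.lt _ _).and (Corr.le _ _)).imp
      (definable₁_mem hbdd _).not))
  have hWb : ∀ t ∈ W, t ≤ d := fun t ht => by
    by_contra h
    exact ht.2 d ⟨hxd, (not_le.1 h).le⟩ hd
  obtain ⟨y, hxy, hy⟩ := hM.bd_right hX hxd
  obtain ⟨w, hxw, hwy⟩ := exists_between hxy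
  have hwW : w ∈ W := ⟨hxw, fun u hu => hy u ⟨hu.1, hu.2.trans_lt hwy⟩⟩
  obtain ⟨s, hs⟩ := hM.exists_isLUB W hWd ⟨w, hwW⟩ ⟨d, hWb⟩
  have hxs : x < s := hxw.trans_le (hs.1 hwW)
  have hlt : ∀ t, x < t ∧ t < s → t ∉ bd X := fun t ht => by
    obtain ⟨u, hu, htu⟩ := (lt_isLUB_iff hs).1 ht.2
    exact hu.2 t ⟨ht.1, htu.le⟩
  refine ⟨s, ?_, hxs, hlt⟩
  by_contra hsb
  have hsd : s < d := lt_of_le_of_ne (hs.2 hWb) (fun h => hsb (h ▸ hd))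
  obtain ⟨y, hsy, hy⟩ := hM.bd_right hX hsd
  obtain ⟨t, hst, hty⟩ := exists_between hsy
  have : t ∈ W := by
    refine ⟨hxs.trans hst, fun u hu => ?_⟩
    rcases lt_trichotomy u s with h | h | h
    · exact hlt u ⟨hu.1, h⟩
    · exact h ▸ hsb
    · exact hy u ⟨h, hu.2.trans_lt hty⟩
  exact absurd (hs.1 this) (not_le.2 hst)

end LocallyOMinimal

end Boundary

/-! ### Algebraic closure equals definable closure in an ordered structure. -/

section AlgebraicClosure

variable {L : FirstOrder.Language.{u, v}} {M : Type w} [L.Structure M] {A B : Set M}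
  [LinearOrder M] [L.IsOrdered] [L.OrderedStructure M]

/-- The least element is definable from the set; remove it and repeat. -/
theorem subset_dcl_of_finite {X : Set M} (hX : X.Finite) (hXA : A.Definable₁ L X) : X ⊆ dcl L A := by
  obtain ⟨n, hn⟩ : ∃ n, X.ncard = n := ⟨_, rfl⟩
  induction n generalizing X with
  | zero =>
    rw [(Set.ncard_eq_zero hX).1 hn]
    exact Set.empty_subset _
  | succ n ih =>
    have hne : X.Nonempty := by
      rw [← Set.ncard_pos hX]
      omega
    obtain ⟨m, hm, hmin⟩ := hX.exists_minimal hne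
    have hmin' : ∀ x ∈ X, m ≤ x := fun x hx => by
      rcases le_total m x with h | h
      · exact h
      · exact hmin hx h
    have hmA : m ∈ dcl L A := by
      change A.Definable₁ L {m}
      rw [definable₁_iff]
      have hmin : DefPred L A (fun v : Unit → M => v () ∈ X ∧ ∀ x, x ∈ X → v () ≤ x) :=
        (definable₁_mem hXA ()).and (Corr.all ((definable₁_mem hXA _).imp (Corr.le _ _)))
      refine hmin.congr ?_ ?_ <;>
      · intro v
        refine ⟨fun h => le_antisymm (h.2 m hm) (hmin' _ h.1), fun h => ?_⟩
        rw [Set.mem_singleton_iff.1 h]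
        exact ⟨hm, hmin'⟩
    intro x hx
    by_cases hxm : x = m
    · exact hxm ▸ hmA
    · refine ih (hX.sdiff (t := {m})) (definable₁_inter hXA (definable₁_compl hmA)) ?_
        ⟨hx, hxm⟩
      rw [Set.ncard_sdiff_singleton_of_mem hm, hn]
      rfl

theorem acl_eq_dcl : acl L A = dcl L A :=
  Set.Subset.antisymm (fun _ ⟨_, hX, hXA, ha⟩ => subset_dcl_of_finite hX hXA ha) dcl_subset_acl

end AlgebraicClosure

/-! ### Finite boundaries, intervals inside types, and exchange. -/

section Trivial

/-- Families of sets definable over a small set that have the finite intersection property have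
nonempty intersection. -/
def SmallSaturated (L : FirstOrder.Language.{u, v}) (M : Type w) [L.Structure M] : Prop :=
  ∀ B : Set M, #B < #M → ∀ Γ : Set (Set M), (∀ X ∈ Γ, B.Definable₁ L X) →
    (∀ F ⊆ Γ, F.Finite → (⋂₀ F).Nonempty) → (⋂₀ Γ).Nonempty

/-- Equality of the types of `c` and `e` over `A`. -/
def TypeEq (L : FirstOrder.Language.{u, v}) {M : Type w} [L.Structure M] (A : Set M) (c e : M) :
    Prop :=
  ∀ X : Set M, A.Definable₁ L X → (c ∈ X ↔ e ∈ X)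

/-- A saturated locally o-minimal structure in which definable closure is given by finitely many
unary functions. -/
structure TrivialMonster (L : FirstOrder.Language.{u, v}) (M : Type w)
    [LinearOrder M] [L.Structure M] {k : ℕ} (f : Fin k → M → M) : Prop where
  locallyOMinimal : LocallyOMinimal L M
  saturated : SmallSaturated L M
  aleph0_lt : ℵ₀ < #M
  zeroDefinable : ∀ i, ZeroDefinable L (f i)
  dcl_eq : ∀ A : Set M, dcl L A = (⋃ i, f i '' A) ∪ dcl L (∅ : Set M)

variable {L : FirstOrder.Language.{u, v}} {M : Type w} [L.Structure M] {A B : Set M}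

theorem TypeEq.symm {c e : M} (h : TypeEq L A c e) : TypeEq L A e c := fun X hX => (h X hX).symm

theorem TypeEq.trans {c d e : M} (h : TypeEq L A c d) (h' : TypeEq L A d e) : TypeEq L A c e :=
  fun X hX => (h X hX).trans (h' X hX)

theorem TypeEq.mem_dcl {c e : M} (h : TypeEq L A c e) (hc : c ∈ dcl L A) : e ∈ dcl L A := by
  have := (h {c} hc).1 rfl
  rw [Set.mem_singleton_iff.1 this]
  exact hc

theorem ZeroDefinable.corr {g : M → M} (hg : ZeroDefinable L g) {α : Type*} (i j : α) :
    DefPred L A (fun v : α → M => g (v i) = v j) := by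
  have h : DefPred L (∅ : Set M) (fun v : Fin 2 → M => g (v 0) = v 1) := defPred_iff.2 hg
  exact (h.mono (Set.empty_subset A)).comp (fun n : Fin 2 => if n = 0 then i else j)

theorem ZeroDefinable.mem_dcl {g : M → M} (hg : ZeroDefinable L g) {a : M} (ha : a ∈ dcl L A) :
    g a ∈ dcl L A := by
  change A.Definable₁ L {g a}
  rw [definable₁_iff]
  refine (DefPred.subst (P := fun v a => g a = v ()) ha (hg.corr _ _)).congr ?_ ?_ <;>
  · intro v
    exact eq_comm

theorem mk_insert_lt (hM : ℵ₀ < #M) (hA : #A < #M) (a : M) : #(insert a A : Set M) < #M :=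
  (mk_insert_le).trans_lt (add_lt_of_lt hM.le hA (one_lt_aleph0.trans hM))

variable [LinearOrder M]

namespace TrivialMonster

variable {k : ℕ} {f : Fin k → M → M}

theorem mem_dcl_iff (hM : TrivialMonster L M f) {a : M} :
    a ∈ dcl L A ↔ (∃ i, ∃ b ∈ A, f i b = a) ∨ a ∈ dcl L (∅ : Set M) := by
  rw [hM.dcl_eq]
  simp

/-- An infinite set meets every finite intersection of cofinite sets, so saturation applies to `X`
together with all cofinite `A`-definable sets. -/
theorem exists_mem_not_mem_acl (hM : TrivialMonster L M f) (hA : #A < #M) {X : Set M}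
    (hX : A.Definable₁ L X) (hinf : X.Infinite) : ∃ x ∈ X, x ∉ acl L A := by
  obtain ⟨x, hx⟩ := hM.saturated A hA (insert X {Y | A.Definable₁ L Y ∧ Yᶜ.Finite}) (by
    rintro Y (rfl | hY)
    · exact hX
    · exact hY.1) (by
    intro F hF hfin
    have hco : (⋂₀ (F \ {X}))ᶜ.Finite := by
      rw [Set.compl_sInter]
      refine Set.Finite.sUnion ((hfin.subset Set.sdiff_subset).image _) ?_
      rintro _ ⟨Y, hY, rfl⟩
      exact ((hF hY.1).resolve_left hY.2).2
    obtain ⟨x, hx, hx'⟩ := hinf.exists_notMem_finite hco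
    refine ⟨x, fun Y hY => ?_⟩
    by_cases h : Y = X
    · exact h ▸ hx
    · exact (not_not.1 hx') Y ⟨hY, h⟩)
  refine ⟨x, hx X (by simp), fun ⟨Y, hY, hYA, hxY⟩ => ?_⟩
  exact hx Yᶜ (Or.inr ⟨definable₁_compl hYA, by simpa using hY⟩) hxY

theorem exists_mem_dcl_singleton (hM : TrivialMonster L M f) {a : M} (ha : a ∈ dcl L A)
    (ha' : a ∉ dcl L (∅ : Set M)) : ∃ b ∈ A, a ∈ dcl L {b} := by
  rcases hM.mem_dcl_iff.1 ha with ⟨i, c, hc, rfl⟩ | h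
  · exact ⟨c, hc, (hM.zeroDefinable i).mem_dcl (subset_dcl rfl)⟩
  · exact absurd h ha'

theorem mem_dcl_trans (hM : TrivialMonster L M f) {a b c : M} (h : a ∈ dcl L {b})
    (h' : b ∈ dcl L {c}) : a ∈ dcl L {c} := by
  rcases hM.mem_dcl_iff.1 h with ⟨i, _, rfl, rfl⟩ | h
  · exact (hM.zeroDefinable i).mem_dcl h'
  · exact dcl_mono (Set.empty_subset _) h

theorem mk_empty_lt (hM : TrivialMonster L M f) : #(∅ : Set M) < #M := by
  rw [mk_eq_zero]
  exact aleph0_pos.trans hM.aleph0_lt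

theorem mk_singleton_lt (hM : TrivialMonster L M f) (a : M) : #({a} : Set M) < #M := by
  rw [mk_singleton]
  exact one_lt_aleph0.trans hM.aleph0_lt

end TrivialMonster

variable [L.IsOrdered] [L.OrderedStructure M]

theorem definable₁_Iic {g : M} (hg : g ∈ dcl L A) : A.Definable₁ L (Set.Iic g) := by
  rw [definable₁_iff]
  exact DefPred.subst (P := fun v a => v () ≤ a) hg (Corr.le _ _)

theorem definable₁_Ici {g : M} (hg : g ∈ dcl L A) : A.Definable₁ L (Set.Ici g) := by
  rw [definable₁_iff]
  exact DefPred.subst (P := fun v a => a ≤ v ()) hg (Corr.le _ _)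

namespace TrivialMonster

variable [DenselyOrdered M] {k : ℕ} {f : Fin k → M → M}

/-- Otherwise some boundary point `x` is not in `dcl(A)`. A boundary point and its successor are
interdefinable over `A`, so the points interdefinable with `x` would run upwards without end; but
all of them are among the finitely many `fᵢ(x)`. -/
theorem bd_finite (hM : TrivialMonster L M f) (hA : #A < #M) {X : Set M}
    (hX : A.Definable₁ L X) : (bd X).Finite := by
  by_contra hinf
  have hbd := definable₁_bd hX
  obtain ⟨x, hx, hxA⟩ := hM.exists_mem_not_mem_acl hA hbd hinf
  rw [acl_eq_dcl] at hxA
  -- The boundary points interdefinable with `x` over `A`. A largest one is either followed by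
  -- another boundary point, again in `Z`, or is the maximum of `bd X`, hence in `dcl(A)`.
  set Z : Set M := {z | z ∈ bd X ∧ z ∉ dcl L A ∧ z ∈ dcl L (insert x A) ∧ x ∈ dcl L (insert z A)}
  have hZ : Z.Finite := by
    refine (Set.finite_range (fun i => f i x)).subset fun z hz => ?_
    rcases hM.mem_dcl_iff.1 hz.2.2.1 with ⟨i, b, hb | hb, hi⟩ | h
    · exact ⟨i, hb ▸ hi⟩
    · exact absurd (hM.mem_dcl_iff.2 (Or.inl ⟨i, b, hb, hi⟩)) hz.2.1
    · exact absurd (dcl_mono (Set.empty_subset A) h) hz.2.1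
  have hxx : x ∈ dcl L (insert x A) := subset_dcl (Set.mem_insert x A)
  obtain ⟨z, hz, hmax⟩ := hZ.exists_maximal ⟨x, hx, hxA, hxx, hxx⟩
  have hcomp : ∀ {a b c : M}, a ∈ dcl L (insert b A) → b ∈ dcl L (insert c A) →
      a ∈ dcl L (insert c A) := fun {a b c} h1 h2 => by
    rw [← dcl_insert_of_mem h2]
    exact dcl_mono (Set.insert_subset_insert (Set.subset_insert _ _)) h1
  have hcompA : ∀ {a b : M}, a ∈ dcl L (insert b A) → b ∈ dcl L A → a ∈ dcl L A :=
    fun h1 h2 => by rwa [dcl_insert_of_mem h2] at h1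
  by_cases hzmax : ∃ d ∈ bd X, z < d
  · obtain ⟨d, hd, hzd⟩ := hzmax
    obtain ⟨s, hs, hzs, hsucc⟩ := hM.locallyOMinimal.exists_bd_succ hX hd hzd
    have h1 : s ∈ dcl L (insert z A) := by
      change (insert z A).Definable₁ L {s}
      rw [definable₁_iff]
      have hzd : z ∈ dcl L (insert z A) := subset_dcl (Set.mem_insert z A)
      have hbd' : (insert z A).Definable₁ L (bd X) := Set.Definable.mono hbd (Set.subset_insert _ _)
      refine (DefPred.subst (P := fun v z => v () ∈ bd X ∧ z < v () ∧
        ∀ t, z < t ∧ t < v () → ¬ t ∈ bd X) hzd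
        ((definable₁_mem hbd' _).and ((Corr.lt _ _).and (Corr.all (((Corr.lt _ _).and
          (Corr.lt _ _)).imp (definable₁_mem hbd' _).not))))).congr ?_ ?_ <;>
      · intro v
        constructor
        · rintro ⟨h1, h2, h3⟩
          rcases lt_trichotomy (v ()) s with h | h | h
          · exact absurd h1 (hsucc _ ⟨h2, h⟩)
          · exact h
          · exact absurd hs (h3 _ ⟨hzs, h⟩)
        · intro h
          rw [Set.mem_singleton_iff.1 h]
          exact ⟨hs, hzs, hsucc⟩
    have h2 : z ∈ dcl L (insert s A) := by
      change (insert s A).Definable₁ L {z}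
      rw [definable₁_iff]
      have hsd : s ∈ dcl L (insert s A) := subset_dcl (Set.mem_insert s A)
      have hbd' : (insert s A).Definable₁ L (bd X) := Set.Definable.mono hbd (Set.subset_insert _ _)
      refine (DefPred.subst (P := fun v s => v () ∈ bd X ∧ v () < s ∧
        ∀ t, v () < t ∧ t < s → ¬ t ∈ bd X) hsd
        ((definable₁_mem hbd' _).and ((Corr.lt _ _).and (Corr.all (((Corr.lt _ _).and
          (Corr.lt _ _)).imp (definable₁_mem hbd' _).not))))).congr ?_ ?_ <;>
      · intro v
        constructor
        · rintro ⟨h1, h2, h3⟩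
          rcases lt_trichotomy (v ()) z with h | h | h
          · exact absurd hz.1 (h3 _ ⟨h, hzs⟩)
          · exact h
          · exact absurd h1 (hsucc _ ⟨h, h2⟩)
        · intro h
          rw [Set.mem_singleton_iff.1 h]
          exact ⟨hz.1, hzs, hsucc⟩
    have hx' := hcomp hz.2.2.2 h2
    exact absurd (hmax ⟨hs, fun h => hxA (hcompA hx' h), hcomp h1 hz.2.2.1, hx'⟩ hzs.le)
      (not_le.2 hzs)
  · push Not at hzmax
    apply hz.2.1
    change A.Definable₁ L {z}
    rw [definable₁_iff]
    have : DefPred L A (fun v : Unit → M => v () ∈ bd X ∧ ∀ d, d ∈ bd X → d ≤ v ()) :=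
      (definable₁_mem hbd _).and (Corr.all ((definable₁_mem hbd _).imp (Corr.le _ _)))
    refine this.congr ?_ ?_ <;>
    · intro v
      refine ⟨fun h => le_antisymm (hzmax _ h.1) (h.2 _ hz.1), fun h => ?_⟩
      rw [Set.mem_singleton_iff.1 h]
      exact ⟨hz.1, hzmax⟩

theorem bd_subset_dcl (hM : TrivialMonster L M f) (hA : #A < #M) {X : Set M}
    (hX : A.Definable₁ L X) : bd X ⊆ dcl L A :=
  subset_dcl_of_finite (hM.bd_finite hA hX) (definable₁_bd hX)

/-- An `A`-definable set separating `c` from `e` has a boundary point `g ∈ dcl(A)` with `c ≤ g ≤ e <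
d`, and then `Iic g` separates `c` from `d`. -/
theorem typeEq_of_between (hM : TrivialMonster L M f) (hA : #A < #M) {c d e : M}
    (h : TypeEq L A c d) (hce : c ≤ e) (hed : e < d) : TypeEq L A c e := by
  rcases hce.eq_or_lt with rfl | hce
  · exact fun _ _ => Iff.rfl
  intro X hX
  by_contra hne
  obtain ⟨g, hg, hcg, hge⟩ := hM.locallyOMinimal.exists_mem_bd hX hce hne
  exact absurd ((h _ (definable₁_Iic (hM.bd_subset_dcl hA hX hg))).1 hcg)
    (not_le.2 (hge.trans_lt hed))

theorem exists_typeEq_Ioo (hM : TrivialMonster L M f) (hA : #A < #M) {c : M} (hc : c ∉ dcl L A) :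
    ∃ lo hi, lo < hi ∧ ∀ e, lo < e ∧ e < hi → TypeEq L A c e := by
  -- A second realization of the type of `c`: an `A`-definable set containing `c` is infinite
  -- because `c ∉ dcl(A)`.
  obtain ⟨d, hd⟩ := hM.saturated (insert c A) (mk_insert_lt hM.aleph0_lt hA c)
    (insert {c}ᶜ {X | A.Definable₁ L X ∧ c ∈ X}) (by
      rintro Y (rfl | hY)
      · exact definable₁_compl (subset_dcl (Set.mem_insert c A))
      · exact Set.Definable.mono hY.1 (Set.subset_insert _ _)) (by
    intro F hF hfin
    have hd : A.Definable₁ L (⋂₀ (F \ {{c}ᶜ})) :=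
      definable₁_sInter (hfin.subset Set.sdiff_subset) fun Y hY => ((hF hY.1).resolve_left hY.2).1
    have hcmem : c ∈ ⋂₀ (F \ {{c}ᶜ}) := fun Y hY => ((hF hY.1).resolve_left hY.2).2
    have hinf : (⋂₀ (F \ {{c}ᶜ})).Infinite := fun hfin => hc (subset_dcl_of_finite hfin hd hcmem)
    obtain ⟨x, hx, hx'⟩ := hinf.exists_notMem_finite (Set.finite_singleton c)
    refine ⟨x, fun Y hY => ?_⟩
    by_cases h : Y = {c}ᶜ
    · exact h ▸ hx'
    · exact hx Y ⟨hY, h⟩)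
  have hcd : TypeEq L A c d := fun X hX => by
    constructor
    · intro h
      exact hd X (Or.inr ⟨hX, h⟩)
    · intro h
      by_contra h'
      exact hd Xᶜ (Or.inr ⟨definable₁_compl hX, h'⟩) h
  have hne : d ≠ c := hd {c}ᶜ (by simp)
  rcases hne.lt_or_gt with h | h
  · exact ⟨d, c, h, fun e he => hcd.trans (hM.typeEq_of_between hA hcd.symm he.1.le he.2)⟩
  · exact ⟨c, d, h, fun e he => hM.typeEq_of_between hA hcd he.1.le he.2⟩

/-- The exchange property. -/
theorem exchange_apply (hM : TrivialMonster L M f) {g : M → M} (hg : ZeroDefinable L g) {a : M}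
    (ha : g a ∉ dcl L (∅ : Set M)) : a ∈ dcl L {g a} := by
  by_contra hna
  have hfib : ∀ b, ({b} : Set M).Definable₁ L {t | g t = b} := fun b => by
    rw [definable₁_iff]
    exact DefPred.subst (P := fun v b => g (v ()) = b) (subset_dcl rfl) (hg.corr _ _)
  -- The points near which `g` is constant. If `a ∉ dcl(g a)`, then `a` is one of them, since the
  -- boundary of its fibre lies in `dcl(g a)`.
  set LC : Set M := {x | x ∉ bd {t | g t = g x}} with hLC
  have hLCd : (∅ : Set M).Definable₁ L LC := by
    rw [definable₁_iff]
    have : DefPred L (∅ : Set M) (fun v : Unit ⊕ Unit → M =>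
        v (Sum.inr ()) ∈ {t | g t = g (v (Sum.inl ()))}) := by
      have : DefPred L (∅ : Set M) (fun v : Unit ⊕ Unit → M =>
          ∃ y, g (v (Sum.inr ())) = y ∧ g (v (Sum.inl ())) = y) :=
        Corr.ex ((hg.corr _ _).and (hg.corr _ _))
      refine this.congr ?_ ?_ <;>
      · intro v
        simp [eq_comm]
    exact ((corr_bd (P := fun v : Unit → M => {t | g t = g (v ())})
      (Q := fun v : Unit → M => {t | g t = g (v ())}) this).comp (fun _ => ())).not
  have hloc : ∀ x, x ∈ LC → ∀ b, x ∉ bd {t | g t = b} := by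
    intro x hx b
    simp only [hLC, bd, Set.mem_ofPred_eq, not_not, iff_true] at hx ⊢
    refine ⟨fun hz => ?_, fun hz => ?_⟩
    · obtain ⟨y, hy, h⟩ := hx.1 hz
      exact ⟨y, hy, fun t ht => by rw [h t ht]⟩
    · obtain ⟨y, hy, h⟩ := hx.2 hz
      exact ⟨y, hy, fun t ht => by rw [h t ht]⟩
  have haLC : a ∈ LC := fun h => hna (hM.bd_subset_dcl (hM.mk_singleton_lt _) (hfib _) h)
  have hDfin := hM.bd_finite hM.mk_empty_lt hLCd
  have hDdcl := hM.bd_subset_dcl hM.mk_empty_lt hLCd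
  -- The piece of `LC` around `a` cut out by the finitely many points of `bd LC`, all in `dcl(∅)`.
  -- It is `0`-definable, and `g` is constant on it because a boundary point of a fibre cannot lie
  -- in `LC`. So `g a` is `0`-definable as the value of `g` on `I`.
  set I : Set M := {x | ∀ d ∈ bd LC, (d ≤ x ↔ d ≤ a) ∧ (x ≤ d ↔ a ≤ d)} with hI
  have hsep : ∀ {Y : Set M} {B : Set M}, B.Definable₁ L Y → ∀ {x}, ¬ (a ∈ Y ↔ x ∈ Y) →
      ∃ c ∈ bd Y, (a ≤ c ∧ c ≤ x) ∨ (x ≤ c ∧ c ≤ a) := by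
    intro Y B hY x hx
    rcases lt_trichotomy a x with h | h | h
    · obtain ⟨c, hc, hc'⟩ := hM.locallyOMinimal.exists_mem_bd hY h hx
      exact ⟨c, hc, Or.inl hc'⟩
    · exact absurd (by rw [h]) hx
    · obtain ⟨c, hc, hc'⟩ := hM.locallyOMinimal.exists_mem_bd hY h (fun h => hx h.symm)
      exact ⟨c, hc, Or.inr hc'⟩
  have hILC : ∀ x ∈ I, x ∈ LC := by
    intro x hx
    by_contra hxLC
    obtain ⟨d, hd, hd'⟩ := hsep hLCd (x := x) (fun h => hxLC (h.1 haLC))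
    obtain ⟨h1, h2⟩ := hx d hd
    have : x = a := by
      rcases hd' with ⟨h3, h4⟩ | ⟨h3, h4⟩
      · exact le_antisymm ((h2.2 h3).trans (h1.1 h4)) (h3.trans h4)
      · exact le_antisymm (h3.trans h4) ((h2.1 h3).trans (h1.2 h4))
    exact hxLC (this ▸ haLC)
  have haI : a ∈ I := fun d _ => ⟨Iff.rfl, Iff.rfl⟩
  have hconst : ∀ x ∈ I, g x = g a := by
    intro x hx
    by_contra hne
    obtain ⟨c, hc, hc'⟩ := hsep (hfib (g a)) (x := x) (fun h => hne (h.1 rfl))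
    refine hloc c (hILC c fun d hd => ?_) (g a) hc
    obtain ⟨h1, h2⟩ := hx d hd
    rcases hc' with ⟨h3, h4⟩ | ⟨h3, h4⟩
    · exact ⟨⟨fun h => h1.1 (h.trans h4), fun h => h.trans h3⟩,
        ⟨fun h => h3.trans h, fun h => h4.trans (h2.2 h)⟩⟩
    · exact ⟨⟨fun h => h.trans h4, fun h => (h1.2 h).trans h3⟩,
        ⟨fun h => h2.1 (h3.trans h), fun h => h4.trans h⟩⟩
  have hId : (∅ : Set M).Definable₁ L I := by
    have : I = ⋂₀ ((fun d => {x | (d ≤ x ↔ d ≤ a) ∧ (x ≤ d ↔ a ≤ d)}) '' bd LC) := by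
      ext x
      simp [hI]
    rw [this]
    refine definable₁_sInter (hDfin.image _) ?_
    rintro _ ⟨d, hd, rfl⟩
    have h1 : (∅ : Set M).Definable₁ L {x | d ≤ x ↔ d ≤ a} := by
      by_cases h : d ≤ a
      · have e : {x | d ≤ x ↔ d ≤ a} = Set.Ici d := by ext; simp [h]
        exact e ▸ definable₁_Ici (hDdcl hd)
      · have e : {x | d ≤ x ↔ d ≤ a} = (Set.Ici d)ᶜ := by ext; simp [h]
        exact e ▸ definable₁_compl (definable₁_Ici (hDdcl hd))
    have h2 : (∅ : Set M).Definable₁ L {x | x ≤ d ↔ a ≤ d} := by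
      by_cases h : a ≤ d
      · have e : {x | x ≤ d ↔ a ≤ d} = Set.Iic d := by ext; simp [h]
        exact e ▸ definable₁_Iic (hDdcl hd)
      · have e : {x | x ≤ d ↔ a ≤ d} = (Set.Iic d)ᶜ := by ext; simp [h]
        exact e ▸ definable₁_compl (definable₁_Iic (hDdcl hd))
    exact definable₁_inter h1 h2
  apply ha
  change (∅ : Set M).Definable₁ L {g a}
  rw [definable₁_iff]
  have : DefPred L (∅ : Set M) (fun v : Unit → M => ∃ x, x ∈ I ∧ g x = v ()) :=
    Corr.ex ((definable₁_mem hId _).and (hg.corr _ _))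
  refine this.congr ?_ ?_ <;>
  · intro v
    constructor
    · rintro ⟨x, hx, h⟩
      exact h.symm.trans (hconst x hx)
    · intro h
      exact ⟨a, haI, h.symm⟩

theorem exchange (hM : TrivialMonster L M f) {a b : M} (ha : a ∈ dcl L {b})
    (ha' : a ∉ dcl L (∅ : Set M)) : b ∈ dcl L {a} := by
  rcases hM.mem_dcl_iff.1 ha with ⟨i, c, rfl, rfl⟩ | h
  · exact hM.exchange_apply (hM.zeroDefinable i) ha'
  · exact absurd h ha'

end TrivialMonster

end Trivial

/-! ### Partial elementary maps, viewed as relations. -/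

section ElementaryRelations

variable {L : FirstOrder.Language.{u, v}} {M : Type w} [L.Structure M]

/-- Every formula is equivalent to a substitution instance of a formula in finitely many
variables. -/
theorem exists_formula_fin {α : Type*} (φ : L.Formula α) :
    ∃ (n : ℕ) (e : Fin n → α) (ψ : L.Formula (Fin n)),
      ∀ v : α → M, φ.Realize v ↔ ψ.Realize (v ∘ e) := by
  classical
  let e := φ.freeVarFinset.equivFin
  refine ⟨_, fun i => (e.symm i).1, φ.restrictFreeVar e, fun v => ?_⟩
  exact (BoundedFormula.realize_restrictFreeVar v (by simp)).symm

theorem definable₁_range_iff {ι : Type*} {a : ι → M} {X : Set M} :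
    (Set.range a).Definable₁ L X ↔
      ∃ φ : L.Formula (ι ⊕ Unit), ∀ x, x ∈ X ↔ φ.Realize (Sum.elim a fun _ => x) := by
  rw [Set.Definable₁, Set.definable_iff_exists_formula_sum]
  constructor
  · rintro ⟨φ, hφ⟩
    choose g hg using fun b : Set.range a => b.2
    refine ⟨φ.relabel (Sum.map g fun _ => ()), fun x => ?_⟩
    have h := Set.ext_iff.1 hφ (fun _ => x)
    simp only [Set.mem_ofPred_eq] at h
    rw [h, Formula.realize_relabel]
    apply iff_of_eq
    congr 1
    funext i
    rcases i with i | i <;> simp [hg]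
  · rintro ⟨φ, hφ⟩
    refine ⟨φ.relabel (Sum.map (fun i => (⟨a i, i, rfl⟩ : Set.range a)) fun _ => 0), ?_⟩
    ext x
    simp only [Set.mem_ofPred_eq, Formula.realize_relabel, hφ]
    apply iff_of_eq
    congr 1
    funext i
    rcases i with i | i <;> simp

/-- Finite tuples from `R` have components that satisfy the same formulas. -/
def IsElementaryRel (L : FirstOrder.Language.{u, v}) {M : Type w} [L.Structure M]
    (R : Set (M × M)) : Prop :=
  ∀ (n : ℕ) (φ : L.Formula (Fin n)) (r : Fin n → M × M), (∀ i, r i ∈ R) →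
    (φ.Realize (fun i => (r i).1) ↔ φ.Realize (fun i => (r i).2))

/-- The domain of a relation. -/
def relDom (R : Set (M × M)) : Set M := Set.range fun r : R => r.1.1

/-- The range of a relation. -/
def relRng (R : Set (M × M)) : Set M := Set.range fun r : R => r.1.2

/-- The converse relation. -/
def converse (R : Set (M × M)) : Set (M × M) := Prod.swap ⁻¹' R

theorem converse_insert (R : Set (M × M)) (a b : M) :
    converse (insert (a, b) R) = insert (b, a) (converse R) := by
  ext ⟨x, y⟩
  simp [converse, and_comm]

theorem relDom_converse (R : Set (M × M)) : relDom (converse R) = relRng R := by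
  ext x
  simp [relDom, relRng, converse]

theorem relRng_converse (R : Set (M × M)) : relRng (converse R) = relDom R := by
  ext x
  simp [relDom, relRng, converse]

theorem mem_relDom {R : Set (M × M)} {p : M × M} (hp : p ∈ R) : p.1 ∈ relDom R := ⟨⟨p, hp⟩, rfl⟩

theorem mem_relRng {R : Set (M × M)} {p : M × M} (hp : p ∈ R) : p.2 ∈ relRng R := ⟨⟨p, hp⟩, rfl⟩

theorem mk_converse (R : Set (M × M)) : #(converse R) = #R :=
  mk_preimage_equiv (Equiv.prodComm M M) R

namespace IsElementaryRel

variable {R : Set (M × M)}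

theorem realize_iff (hR : IsElementaryRel L R) {α : Type*} (φ : L.Formula α) (r : α → M × M)
    (hr : ∀ i, r i ∈ R) : φ.Realize (fun i => (r i).1) ↔ φ.Realize (fun i => (r i).2) := by
  obtain ⟨n, e, ψ, h⟩ := exists_formula_fin (M := M) φ
  rw [h, h]
  exact hR n ψ (r ∘ e) fun i => hr _

theorem converse (hR : IsElementaryRel L R) : IsElementaryRel L (converse R) :=
  fun n φ r hr => (hR n φ (fun i => (r i).swap) hr).symm

theorem eq_iff (hR : IsElementaryRel L R) {p q : M × M} (hp : p ∈ R) (hq : q ∈ R) :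
    p.1 = q.1 ↔ p.2 = q.2 := by
  have := hR 2 ((Term.var 0).equal (Term.var 1)) ![p, q] (by
    intro i
    fin_cases i <;> assumption)
  simpa [Formula.realize_equal] using this

theorem insert_iff {c c' : M} : IsElementaryRel L (insert (c, c') R) ↔
    ∀ φ : L.Formula (R ⊕ Unit), φ.Realize (Sum.elim (fun r => r.1.1) fun _ => c) ↔
      φ.Realize (Sum.elim (fun r => r.1.2) fun _ => c') := by
  classical
  constructor
  · intro h φ
    have := h.realize_iff φ (Sum.elim (fun r => r.1) fun _ => (c, c')) (by
      rintro (r | r)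
      · exact Or.inr r.2
      · exact Or.inl rfl)
    convert this using 2 <;>
    · funext i
      rcases i with i | i <;> rfl
  · intro h n φ r hr
    have := h (φ.relabel fun i => if hi : r i ∈ R then Sum.inl ⟨r i, hi⟩ else Sum.inr ())
    rw [Formula.realize_relabel, Formula.realize_relabel] at this
    convert this using 2 <;>
    · funext i
      by_cases hi : r i ∈ R
      · simp [hi]
      · have : r i = (c, c') := (hr i).resolve_right hi
        have hi' : (c, c') ∉ R := this ▸ hi
        simp [this, hi']

/-- This allows the image supplied by saturation to be moved into `H'`, or away from `dcl(relRng R ∪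
H')`. -/
theorem insert_of_typeEq {c c' e : M} (h : IsElementaryRel L (insert (c, c') R))
    (he : TypeEq L (relRng R) c' e) : IsElementaryRel L (insert (c, e) R) := by
  rw [insert_iff] at h ⊢
  intro φ
  rw [h φ]
  exact he {x | φ.Realize (Sum.elim (fun r : R => r.1.2) fun _ => x)}
    (definable₁_range_iff.2 ⟨φ, fun x => Iff.rfl⟩)

theorem mem_dcl {c c' : M} (h : IsElementaryRel L (insert (c, c') R))
    (hc : c ∈ dcl L (relDom R)) : c' ∈ dcl L (relRng R) := by
  obtain ⟨φ, hφ⟩ := definable₁_range_iff.1 hc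
  rw [insert_iff] at h
  have h1 := h φ
  -- Uniqueness of the solution of `φ` is itself a formula in the parameters, so it carries over to
  -- the range.
  have h2 := h ((φ.iExsUnique Unit).relabel Sum.inl)
  simp only [Formula.realize_relabel, Formula.realize_iExsUnique, Sum.elim_comp_inl] at h2
  have hu : ∃! i : Unit → M, φ.Realize (Sum.elim (fun r : R => r.1.1) i) :=
    ⟨fun _ => c, (hφ c).1 rfl, fun y hy => by
      funext i
      exact (hφ (y i)).2 hy⟩
  obtain ⟨y, hy, hy'⟩ := h2.1 hu
  have hc' := h1.1 ((hφ c).1 rfl)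
  refine definable₁_range_iff.2 ⟨φ, fun x => ?_⟩
  constructor
  · intro hx
    rw [Set.mem_singleton_iff.1 hx]
    exact hc'
  · intro hx
    have := (hy' _ hx).trans (hy' _ hc').symm
    exact congrFun this ()

theorem exists_insert (hS : SmallSaturated L M) (hR : IsElementaryRel L R) (hsmall : #R < #M)
    (c : M) : ∃ c', IsElementaryRel L (insert (c, c') R) := by
  let S : L.Formula (R ⊕ Unit) → Set M := fun φ =>
    {x | φ.Realize (Sum.elim (fun r : R => r.1.2) fun _ => x)}
  let Γ : Set (Set M) :=
    {X | ∃ φ : L.Formula (R ⊕ Unit), φ.Realize (Sum.elim (fun r : R => r.1.1) fun _ => c) ∧ X = S φ}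
  obtain ⟨c', hc'⟩ := hS (relRng R) (mk_range_le.trans_lt hsmall) Γ (by
    rintro _ ⟨φ, -, rfl⟩
    exact definable₁_range_iff.2 ⟨φ, fun x => Iff.rfl⟩) (by
    intro F hF hfin
    have hmem : ⋂₀ F ∈ Γ := by
      induction F, hfin using Set.Finite.induction_on with
      | empty => exact ⟨⊤, by simp, by ext; simp [S]⟩
      | @insert X F hX _ ih =>
        obtain ⟨φ, hφ, hφ'⟩ := hF (Set.mem_insert X F)
        obtain ⟨ψ, hψ, hψ'⟩ := ih ((Set.subset_insert X F).trans hF)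
        refine ⟨φ ⊓ ψ, Formula.realize_inf.2 ⟨hφ, hψ⟩, ?_⟩
        rw [Set.sInter_insert, hφ', hψ']
        ext x
        exact Formula.realize_inf.symm
    obtain ⟨φ, hφ, hφ'⟩ := hmem
    rw [hφ']
    have := (hR.realize_iff (φ.iExs Unit) (fun r : R => r.1) fun r => r.2).1
      (Formula.realize_iExs.2 ⟨fun _ => c, hφ⟩)
    obtain ⟨x, hx⟩ := Formula.realize_iExs.1 this
    exact ⟨x (), hx⟩)
  refine ⟨c', insert_iff.2 fun φ => ⟨fun h => hc' _ ⟨φ, h, rfl⟩, fun h => ?_⟩⟩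
  by_contra h'
  exact hc' _ ⟨∼φ, h', rfl⟩ h

theorem iUnion {J : Type*} [LinearOrder J] {G : J → Set (M × M)} (hG : Monotone G)
    (h : ∀ j, IsElementaryRel L (G j)) : IsElementaryRel L (⋃ j, G j) := by
  intro n φ r hr
  choose g hg using fun i => Set.mem_iUnion.1 (hr i)
  rcases isEmpty_or_nonempty (Fin n) with hn | hn
  · apply iff_of_eq
    congr 1
    exact Subsingleton.elim _ _
  · obtain ⟨i, hi⟩ := Finite.exists_max g
    exact h (g i) n φ r fun j => hG (hi j) (hg j)

theorem exists_equiv (hR : IsElementaryRel L R) (h1 : ∀ c, ∃ c', (c, c') ∈ R)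
    (h2 : ∀ c', ∃ c, (c, c') ∈ R) : ∃ e : M ≃[L] M, ∀ c, (c, e c) ∈ R := by
  choose g hg using h1
  have hbij : Function.Bijective g := by
    refine ⟨fun a b hab => (hR.eq_iff (hg a) (hg b)).2 hab, fun c' => ?_⟩
    obtain ⟨c, hc⟩ := h2 c'
    exact ⟨c, (hR.eq_iff (hg c) hc).1 rfl⟩
  have key : ∀ {α : Type} (φ : L.Formula α) (v : α → M), φ.Realize v ↔ φ.Realize (g ∘ v) :=
    fun φ v => hR.realize_iff φ (fun i => (v i, g (v i))) fun i => hg _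
  refine ⟨⟨Equiv.ofBijective g hbij, fun {n} F x => ?_, fun {n} r x => ?_⟩, hg⟩
  · have := (key (Term.equal (Term.func F fun i => Term.var (Sum.inl i))
      (Term.var (Sum.inr ())) : L.Formula (Fin n ⊕ Unit))
      (Sum.elim x fun _ => Structure.funMap F x)).1 (by simp [Formula.realize_equal])
    simp only [Formula.realize_equal, Term.realize_func, Term.realize_var] at this
    exact this.symm
  · have := key (Relations.formula r fun i => Term.var i) x
    simp only [Formula.realize_rel, Term.realize_var] at this
    exact this.symm

end IsElementaryRel

end ElementaryRelations

/-! ### Transfinite chains. -/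

section Chains

/-- Transfinite construction of a chain of sets that takes care of a well-ordered set of tasks. -/
theorem exists_chain {ι X : Type*} [LinearOrder ι] [WellFoundedLT ι] (P : Set X → Prop)
    (done : ι → Set X → Prop)
    (hunion : ∀ (i : ι) (G : Set.Iio i → Set X), Monotone G → (∀ j, P (G j)) → P (⋃ j, G j))
    (hstep : ∀ i s, P s → ∃ t, s ⊆ t ∧ P t ∧ done i t) :
    ∃ G : ι → Set X, Monotone G ∧ ∀ i, P (G i) ∧ done i (G i) := by
  classical
  choose! ext hext using hstep
  let G : ι → Set X := WellFoundedLT.fix (fun i ih => ext i (⋃ j : Set.Iio i, ih j.1 j.2))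
  have hG : ∀ i, G i = ext i (⋃ j : Set.Iio i, G j.1) := fun i => WellFoundedLT.fix_eq _ i
  -- Inclusion of the earlier stages belongs to the induction, because `hunion` needs a monotone
  -- family below `i`.
  have key : ∀ i, P (G i) ∧ done i (G i) ∧ ∀ j < i, G j ⊆ G i := by
    intro i
    induction i using WellFoundedLT.induction with
    | ind i ih =>
      have hP : P (⋃ j : Set.Iio i, G j.1) := by
        refine hunion i _ (fun j j' hjj' => ?_) fun j => (ih j.1 j.2).1
        rcases hjj'.eq_or_lt with rfl | hlt
        · exact subset_rfl
        · exact (ih j'.1 j'.2).2.2 j.1 hlt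
      obtain ⟨h1, h2, h3⟩ := hext i _ hP
      rw [hG i]
      exact ⟨h2, h3, fun j hj => (Set.subset_iUnion (fun j : Set.Iio i => G j.1) ⟨j, hj⟩).trans h1⟩
  refine ⟨G, fun j i hji => ?_, fun i => ⟨(key i).1, (key i).2.1⟩⟩
  rcases hji.eq_or_lt with rfl | hlt
  · exact subset_rfl
  · exact (key i).2.2 j hlt

end Chains

/-! ### The back-and-forth between two dense independent sets. -/

section BackAndForth

variable {L : FirstOrder.Language.{u, v}} {M : Type w} [L.Structure M]

/-- A dense independent subset with the extension property, relative to functions `f` that generate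
the definable closure. -/
structure DenseIndependent (L : FirstOrder.Language.{u, v}) {M : Type w} [L.Structure M]
    [LinearOrder M] {k : ℕ} (f : Fin k → M → M) (H : Set M) : Prop where
  not_mem_dcl : ∀ h ∈ H, h ∉ dcl L (∅ : Set M)
  eq_of_mem_dcl : ∀ h ∈ H, ∀ h' ∈ H, h ∈ dcl L {h'} → h = h'
  dense : ∀ lo hi : M, lo < hi → ∃ h ∈ H, lo < h ∧ h < hi
  extension : ∀ lo hi : M, lo < hi → ∃ e, (lo < e ∧ e < hi) ∧ ∀ i, ∀ y ∈ H, f i y ≠ e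

/-- The partial isomorphisms between `(M, H)` and `(M, H')` used in the back-and-forth argument. -/
structure GoodRel (L : FirstOrder.Language.{u, v}) {M : Type w} [L.Structure M]
    (H H' : Set M) (R : Set (M × M)) : Prop where
  elem : IsElementaryRel L R
  pred : ∀ p ∈ R, p.1 ∈ H ↔ p.2 ∈ H'
  left : ∀ p ∈ R, ∀ h ∈ H, p.1 ∈ dcl L {h} → p.1 ∉ dcl L (∅ : Set M) → h ∈ relDom R
  right : ∀ p ∈ R, ∀ h ∈ H', p.2 ∈ dcl L {h} → p.2 ∉ dcl L (∅ : Set M) → h ∈ relRng R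

theorem relDom_mono {R S : Set (M × M)} (h : R ⊆ S) : relDom R ⊆ relDom S := by
  rintro _ ⟨r, rfl⟩
  exact mem_relDom (h r.2)

theorem relRng_mono {R S : Set (M × M)} (h : R ⊆ S) : relRng R ⊆ relRng S := by
  rintro _ ⟨r, rfl⟩
  exact mem_relRng (h r.2)

namespace GoodRel

variable {H H' : Set M} {R : Set (M × M)}

theorem converse (hR : GoodRel L H H' R) : GoodRel L H' H (converse R) where
  elem := hR.elem.converse
  pred p hp := (hR.pred _ hp).symm
  left p hp h hh h1 h2 := by
    rw [relDom_converse]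
    exact hR.right _ hp h hh h1 h2
  right p hp h hh h1 h2 := by
    rw [relRng_converse]
    exact hR.left _ hp h hh h1 h2

theorem iUnion {J : Type*} [LinearOrder J] {G : J → Set (M × M)} (hG : Monotone G)
    (h : ∀ j, GoodRel L H H' (G j)) : GoodRel L H H' (⋃ j, G j) where
  elem := IsElementaryRel.iUnion hG fun j => (h j).elem
  pred p hp := by
    obtain ⟨j, hj⟩ := Set.mem_iUnion.1 hp
    exact (h j).pred p hj
  left p hp a ha h1 h2 := by
    obtain ⟨j, hj⟩ := Set.mem_iUnion.1 hp
    exact relDom_mono (Set.subset_iUnion G j) ((h j).left p hj a ha h1 h2)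
  right p hp a ha h1 h2 := by
    obtain ⟨j, hj⟩ := Set.mem_iUnion.1 hp
    exact relRng_mono (Set.subset_iUnion G j) ((h j).right p hj a ha h1 h2)

theorem insert {c c' : M} (hR : GoodRel L H H' R)
    (helem : IsElementaryRel L (insert (c, c') R)) (hpred : c ∈ H ↔ c' ∈ H')
    (hleft : ∀ h ∈ H, c ∈ dcl L {h} → c ∉ dcl L (∅ : Set M) → h ∈ relDom (insert (c, c') R))
    (hright : ∀ h ∈ H', c' ∈ dcl L {h} → c' ∉ dcl L (∅ : Set M) →
      h ∈ relRng (insert (c, c') R)) : GoodRel L H H' (insert (c, c') R) where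
  elem := helem
  pred p hp := by
    rcases hp with rfl | hp
    · exact hpred
    · exact hR.pred p hp
  left p hp := by
    rcases hp with rfl | hp
    · exact hleft
    · exact fun h hh h1 h2 => relDom_mono (Set.subset_insert _ _) (hR.left p hp h hh h1 h2)
  right p hp := by
    rcases hp with rfl | hp
    · exact hright
    · exact fun h hh h1 h2 => relRng_mono (Set.subset_insert _ _) (hR.right p hp h hh h1 h2)

end GoodRel

namespace TrivialMonster

variable [LinearOrder M] [L.IsOrdered] [L.OrderedStructure M] [DenselyOrdered M] {k : ℕ} {f : Fin k → M → M}
  {H H' A : Set M} {R : Set (M × M)}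

theorem exists_typeEq_mem (hM : TrivialMonster L M f) (hH : DenseIndependent L f H) (hA : #A < #M)
    {c : M} (hc : c ∉ dcl L A) : ∃ h ∈ H, TypeEq L A c h := by
  obtain ⟨lo, hi, hlt, h⟩ := hM.exists_typeEq_Ioo hA hc
  obtain ⟨a, ha, ha'⟩ := hH.dense lo hi hlt
  exact ⟨a, ha, h a ha'⟩

theorem exists_typeEq_not_mem_dcl (hM : TrivialMonster L M f) (hH : DenseIndependent L f H)
    (hA : #A < #M) {c : M} (hc : c ∉ dcl L A) : ∃ e, TypeEq L A c e ∧ e ∉ dcl L (A ∪ H) := by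
  obtain ⟨lo, hi, hlt, h⟩ := hM.exists_typeEq_Ioo hA hc
  obtain ⟨e, he, he'⟩ := hH.extension lo hi hlt
  have hce := h e he
  refine ⟨e, hce, fun hmem => ?_⟩
  have heA : e ∉ dcl L A := fun h' => hc (hce.symm.mem_dcl h')
  rcases hM.mem_dcl_iff.1 hmem with ⟨i, b, hb | hb, hib⟩ | h'
  · exact heA (hM.mem_dcl_iff.2 (Or.inl ⟨i, b, hb, hib⟩))
  · exact he' i b hb hib
  · exact heA (dcl_mono (Set.empty_subset A) h')

/-- A good relation contains each element of `H` that depends on its domain. -/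
theorem mem_relDom_of_mem_dcl (hM : TrivialMonster L M f) (hR : GoodRel L H H' R) {c h : M}
    (hc : c ∈ dcl L (relDom R)) (hh : h ∈ H) (hch : c ∈ dcl L {h}) (hc' : c ∉ dcl L (∅ : Set M)) :
    h ∈ relDom R := by
  -- A single `a` in the domain already defines `c`. By exchange `a ∈ dcl(c) ⊆ dcl(h)`, and the
  -- closure condition of `GoodRel` applies to `a`.
  obtain ⟨a, ⟨r, rfl⟩, hca⟩ := hM.exists_mem_dcl_singleton hc hc'
  have hac := hM.exchange hca hc'
  refine hR.left r.1 r.2 h hh (hM.mem_dcl_trans hac hch) fun ha => hc' ?_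
  rcases hM.mem_dcl_iff.1 hca with ⟨i, b, rfl, rfl⟩ | h'
  · exact (hM.zeroDefinable i).mem_dcl ha
  · exact h'

theorem mem_relRng_of_mem_dcl (hM : TrivialMonster L M f) (hR : GoodRel L H H' R) {c h : M}
    (hc : c ∈ dcl L (relRng R)) (hh : h ∈ H') (hch : c ∈ dcl L {h}) (hc' : c ∉ dcl L (∅ : Set M)) :
    h ∈ relRng R := by
  rw [← relDom_converse] at hc ⊢
  exact hM.mem_relDom_of_mem_dcl hR.converse hc hh hch hc'

/-- A new `c ∈ H` is outside `dcl(relDom R)`, so density gives an image in `H'`. Independence makes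
`c` the only element of `H` on which `c` depends, and likewise for the image. -/
theorem forth_of_mem (hM : TrivialMonster L M f) (hH : DenseIndependent L f H)
    (hH' : DenseIndependent L f H') (hR : GoodRel L H H' R) (hsmall : #R < #M) {c : M}
    (hc : c ∈ H) : ∃ c', GoodRel L H H' (insert (c, c') R) := by
  by_cases hdom : c ∈ relDom R
  · obtain ⟨r, rfl⟩ := hdom
    exact ⟨r.1.2, by rwa [Set.insert_eq_of_mem r.2]⟩
  have hcR : c ∉ dcl L (relDom R) := fun h =>
    hdom (hM.mem_relDom_of_mem_dcl hR h hc (subset_dcl rfl) (hH.not_mem_dcl c hc))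
  obtain ⟨d, hd⟩ := hR.elem.exists_insert hM.saturated hsmall c
  have hdR : d ∉ dcl L (relRng R) := fun h => by
    have := hd.converse
    rw [converse_insert] at this
    rw [← relDom_converse] at h
    have := this.mem_dcl h
    rw [relRng_converse] at this
    exact hcR this
  obtain ⟨e, he, hde⟩ := hM.exists_typeEq_mem hH' (mk_range_le.trans_lt hsmall) hdR
  refine ⟨e, hR.insert (hd.insert_of_typeEq hde) (iff_of_true hc he) ?_ ?_⟩
  · intro h hh h1 _
    rw [← hH.eq_of_mem_dcl c hc h hh h1]
    exact mem_relDom (p := (c, e)) (Set.mem_insert _ _)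
  · intro h hh h1 _
    rw [← hH'.eq_of_mem_dcl e he h hh h1]
    exact mem_relRng (p := (c, e)) (Set.mem_insert _ _)

theorem forth_of_mem_dcl (hM : TrivialMonster L M f) (hH' : DenseIndependent L f H')
    (hR : GoodRel L H H' R) (hsmall : #R < #M) {c : M} (hcH : c ∉ H)
    (hc : c ∈ dcl L (relDom R)) : ∃ c', GoodRel L H H' (insert (c, c') R) := by
  by_cases hdom : c ∈ relDom R
  · obtain ⟨r, rfl⟩ := hdom
    exact ⟨r.1.2, by rwa [Set.insert_eq_of_mem r.2]⟩
  obtain ⟨d, hd⟩ := hR.elem.exists_insert hM.saturated hsmall c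
  have hdR : d ∈ dcl L (relRng R) := hd.mem_dcl hc
  -- If `d` were in `H'`, it would already lie in the range, and its preimage there would have to be
  -- `c`.
  have hdH : d ∉ H' := fun h => by
    obtain ⟨r, hr⟩ := hM.mem_relRng_of_mem_dcl hR hdR h (subset_dcl rfl) (hH'.not_mem_dcl d h)
    refine hdom ⟨r, ?_⟩
    exact (hd.eq_iff (p := r.1) (q := (c, d)) (Or.inr r.2) (Or.inl rfl)).2 hr
  refine ⟨d, hR.insert hd (iff_of_false hcH hdH) ?_ ?_⟩
  · intro h hh h1 h2
    exact relDom_mono (Set.subset_insert _ _) (hM.mem_relDom_of_mem_dcl hR hc hh h1 h2)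
  · intro h hh h1 h2
    exact relRng_mono (Set.subset_insert _ _) (hM.mem_relRng_of_mem_dcl hR hdR hh h1 h2)

/-- If `c` depends on some `h ∈ H`, then `h` has to be added before `c` to keep the closure
condition. If `c` depends neither on the domain nor on an element of `H`, the extension property
gives an image outside `dcl(relRng R ∪ H')`. -/
theorem forth (hM : TrivialMonster L M f) (hH : DenseIndependent L f H)
    (hH' : DenseIndependent L f H') (hR : GoodRel L H H' R) (hsmall : #R < #M) (c : M) :
    ∃ S, R ⊆ S ∧ GoodRel L H H' S ∧ #S < #M ∧ c ∈ relDom S := by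
  have hins : ∀ {S : Set (M × M)} (p : M × M), #S < #M → #(insert p S : Set (M × M)) < #M :=
    fun p hS => mk_insert_le.trans_lt
      (add_lt_of_lt hM.aleph0_lt.le hS (one_lt_aleph0.trans hM.aleph0_lt))
  have hfin : (∃ c', GoodRel L H H' (insert (c, c') R)) →
      ∃ S, R ⊆ S ∧ GoodRel L H H' S ∧ #S < #M ∧ c ∈ relDom S := fun ⟨c', h⟩ =>
    ⟨_, Set.subset_insert _ _, h, hins _ hsmall, mem_relDom (p := (c, c')) (Set.mem_insert _ _)⟩
  by_cases hcH : c ∈ H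
  · exact hfin (hM.forth_of_mem hH hH' hR hsmall hcH)
  by_cases hcR : c ∈ dcl L (relDom R)
  · exact hfin (hM.forth_of_mem_dcl hH' hR hsmall hcH hcR)
  by_cases hch : ∃ h ∈ H, c ∈ dcl L {h}
  · obtain ⟨h, hh, hch⟩ := hch
    obtain ⟨h', hS⟩ := hM.forth_of_mem hH hH' hR hsmall hh
    have hmem : h ∈ relDom (insert (h, h') R) := mem_relDom (p := (h, h')) (Set.mem_insert _ _)
    obtain ⟨c', hc'⟩ := hM.forth_of_mem_dcl hH' hS (hins _ hsmall) hcH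
      (dcl_mono (Set.singleton_subset_iff.2 hmem) hch)
    exact ⟨_, (Set.subset_insert _ _).trans (Set.subset_insert _ _), hc', hins _ (hins _ hsmall),
      mem_relDom (p := (c, c')) (Set.mem_insert _ _)⟩
  · obtain ⟨d, hd⟩ := hR.elem.exists_insert hM.saturated hsmall c
    have hdR : d ∉ dcl L (relRng R) := fun h => by
      have := hd.converse
      rw [converse_insert] at this
      rw [← relDom_converse] at h
      have := this.mem_dcl h
      rw [relRng_converse] at this
      exact hcR this
    obtain ⟨e, hde, he⟩ := hM.exists_typeEq_not_mem_dcl hH' (mk_range_le.trans_lt hsmall) hdR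
    refine hfin ⟨e, hR.insert (hd.insert_of_typeEq hde) (iff_of_false hcH fun h => ?_) ?_ ?_⟩
    · exact he (subset_dcl (Or.inr h))
    · exact fun h hh h1 _ => absurd ⟨h, hh, h1⟩ hch
    · exact fun h hh h1 _ => (he (dcl_mono (Set.singleton_subset_iff.2 (Set.mem_union_right _ hh)) h1)).elim

theorem back (hM : TrivialMonster L M f) (hH : DenseIndependent L f H)
    (hH' : DenseIndependent L f H') (hR : GoodRel L H H' R) (hsmall : #R < #M) (c : M) :
    ∃ S, R ⊆ S ∧ GoodRel L H H' S ∧ #S < #M ∧ c ∈ relRng S := by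
  obtain ⟨S, h1, h2, h3, h4⟩ := hM.forth hH' hH hR.converse (by rwa [mk_converse]) c
  exact ⟨converse S, fun p hp => h1 (a := p.swap) hp, h2.converse, by rwa [mk_converse],
    by rwa [relRng_converse]⟩

theorem exists_equiv (hM : TrivialMonster L M f) (hreg : (#M).IsRegular)
    (hH : DenseIndependent L f H) (hH' : DenseIndependent L f H') :
    ∃ e : M ≃[L] M, ∀ c, c ∈ H ↔ e c ∈ H' := by
  let ι := (#M).ord.ToType
  obtain ⟨t⟩ : Nonempty (ι ≃ M) := Cardinal.eq.1 (mk_ord_toType _)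
  obtain ⟨G, hG, hG'⟩ := exists_chain (ι := ι) (fun R : Set (M × M) => GoodRel L H H' R ∧ #R < #M)
    (fun i R => t i ∈ relDom R ∧ t i ∈ relRng R) (by
      intro i G hG hP
      refine ⟨GoodRel.iUnion hG fun j => (hP j).1, ?_⟩
      -- Regularity keeps the union of fewer than `#M` small stages small.
      exact (card_iUnion_lt_iff_forall_of_isRegular hreg ((mk_Iio_lt i (by simp [ι])).trans_eq (mk_ord_toType _))).2
        fun j => (hP j).2) (by
      rintro i R ⟨hR, hRs⟩
      obtain ⟨S, h1, h2, h3, h4⟩ := hM.forth hH hH' hR hRs (t i)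
      obtain ⟨S', h1', h2', h3', h4'⟩ := hM.back hH hH' h2 h3 (t i)
      exact ⟨S', h1.trans h1', ⟨h2', h3'⟩, relDom_mono h1' h4, h4'⟩)
  -- The union of all stages need not be small, but only its being a good relation matters from here
  -- on.
  have hgood := GoodRel.iUnion hG fun j => (hG' j).1.1
  obtain ⟨e, he⟩ := hgood.elem.exists_equiv (fun c => by
    obtain ⟨r, hr⟩ := (hG' (t.symm c)).2.1
    simp only [Equiv.apply_symm_apply] at hr
    refine ⟨r.1.2, Set.mem_iUnion.2 ⟨t.symm c, ?_⟩⟩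
    rw [← show r.1 = (c, r.1.2) from Prod.ext hr rfl]
    exact r.2) (fun c => by
    obtain ⟨r, hr⟩ := (hG' (t.symm c)).2.2
    simp only [Equiv.apply_symm_apply] at hr
    refine ⟨r.1.1, Set.mem_iUnion.2 ⟨t.symm c, ?_⟩⟩
    rw [← show r.1 = (r.1.1, c) from Prod.ext rfl hr]
    exact r.2)
  exact ⟨e, fun c => hgood.pred _ (he c)⟩

end TrivialMonster

end BackAndForth

/-! ### Local o-minimality and its transfer along elementary equivalence. -/

section OMinimalStructures

variable {L : FirstOrder.Language.{u, v}}

theorem exists_isLUB_sUnion {N : Type*} [LinearOrder N] [DenselyOrdered N] {F : Set (Set N)}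
    (hF : F.Finite) (h : ∀ t ∈ F, IsPointOrInterval t) (hne : (⋃₀ F).Nonempty)
    (hbdd : BddAbove (⋃₀ F)) : ∃ s, IsLUB (⋃₀ F) s := by
  induction F, hF using Set.Finite.induction_on with
  | empty => simp at hne
  | @insert t F _ _ ih =>
    rw [Set.sUnion_insert] at hne hbdd ⊢
    have hb := bddAbove_union.1 hbdd
    have ht : t.Nonempty → ∃ s, IsLUB t s := by
      rintro ⟨x, hx⟩
      obtain ⟨u, hu⟩ := hb.1
      rcases h t (Set.mem_insert t F) with ⟨a, rfl⟩ | ⟨a, b, rfl⟩ | ⟨a, rfl⟩ | ⟨a, rfl⟩ | rfl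
      · exact ⟨a, isLUB_singleton⟩
      · exact ⟨b, isLUB_Ioo (hx.1.trans hx.2)⟩
      · refine ⟨a, fun y hy => le_of_lt hy, fun y hy => ?_⟩
        by_contra hlt
        obtain ⟨z, hz, hz'⟩ := exists_between (not_le.1 hlt)
        exact absurd (hy hz') (not_le.2 hz)
      -- An upper bound of a nonempty `Ioi a` belongs to it and is its maximum.
      · exact ⟨u, IsGreatest.isLUB ⟨lt_of_lt_of_le hx (hu hx), hu⟩⟩
      · exact ⟨u, IsGreatest.isLUB ⟨Set.mem_univ u, hu⟩⟩
    rcases t.eq_empty_or_nonempty with rfl | hne'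
    · rw [Set.empty_union] at hne ⊢
      exact ih (fun t ht => h t (Set.mem_insert_of_mem _ ht)) hne hb.2
    · obtain ⟨s, hs⟩ := ht hne'
      rcases (⋃₀ F).eq_empty_or_nonempty with he | hne'
      · rw [he, Set.union_empty]
        exact ⟨s, hs⟩
      · obtain ⟨s', hs'⟩ := ih (fun t ht => h t (Set.mem_insert_of_mem _ ht)) hne' hb.2
        exact ⟨_, hs.union hs'⟩

theorem sUnion_right {N : Type*} [LinearOrder N] {F : Set (Set N)}
    (hF : F.Finite) (h : ∀ t ∈ F, IsPointOrInterval t) {g z : N} (hgz : g < z) :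
    ∃ y, g < y ∧ ((∀ t, g < t ∧ t < y → t ∈ ⋃₀ F) ∨ ∀ t, g < t ∧ t < y → t ∉ ⋃₀ F) := by
  induction F, hF using Set.Finite.induction_on with
  | empty => exact ⟨z, hgz, Or.inr fun t _ => by simp⟩
  | @insert X F _ _ ih =>
    rw [Set.sUnion_insert]
    obtain ⟨y, hy, hy'⟩ := ih fun t ht => h t (Set.mem_insert_of_mem _ ht)
    have hX : ∃ y, g < y ∧ ((∀ t, g < t ∧ t < y → t ∈ X) ∨ ∀ t, g < t ∧ t < y → t ∉ X) := by
      rcases h X (Set.mem_insert X F) with ⟨a, rfl⟩ | ⟨a, b, rfl⟩ | ⟨a, rfl⟩ | ⟨a, rfl⟩ | rfl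
      · rcases lt_or_ge g a with ha | ha
        · exact ⟨a, ha, Or.inr fun t ht => ht.2.ne⟩
        · exact ⟨z, hgz, Or.inr fun t ht => (ha.trans_lt ht.1).ne'⟩
      · rcases lt_or_ge g a with ha | ha
        · exact ⟨a, ha, Or.inr fun t ht h => lt_asymm h.1 ht.2⟩
        rcases lt_or_ge g b with hb | hb
        · exact ⟨b, hb, Or.inl fun t ht => ⟨ha.trans_lt ht.1, ht.2⟩⟩
        · exact ⟨z, hgz, Or.inr fun t ht h => lt_asymm h.2 (hb.trans_lt ht.1)⟩
      · rcases lt_or_ge g a with ha | ha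
        · exact ⟨a, ha, Or.inl fun t ht => ht.2⟩
        · exact ⟨z, hgz, Or.inr fun t ht h => lt_asymm h (ha.trans_lt ht.1)⟩
      · rcases lt_or_ge g a with ha | ha
        · exact ⟨a, ha, Or.inr fun t ht h => lt_asymm h ht.2⟩
        · exact ⟨z, hgz, Or.inl fun t ht => ha.trans_lt ht.1⟩
      · exact ⟨z, hgz, Or.inl fun t _ => Set.mem_univ t⟩
    obtain ⟨x, hx, hx'⟩ := hX
    have hl : ∀ {t}, g < t ∧ t < min x y → g < t ∧ t < x := fun ht =>
      ⟨ht.1, ht.2.trans_le (min_le_left _ _)⟩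
    have hr : ∀ {t}, g < t ∧ t < min x y → g < t ∧ t < y := fun ht =>
      ⟨ht.1, ht.2.trans_le (min_le_right _ _)⟩
    refine ⟨min x y, lt_min hx hy, ?_⟩
    rcases hx' with hx' | hx'
    · exact Or.inl fun t ht => Or.inl (hx' t (hl ht))
    rcases hy' with hy' | hy'
    · exact Or.inl fun t ht => Or.inr (hy' t (hr ht))
    · exact Or.inr fun t ht h => h.elim (hx' t (hl ht)) (hy' t (hr ht))

theorem IsOMinimal.locallyOMinimal {N : Type w'} [LinearOrder N] [DenselyOrdered N]
    [L.Structure N] (hN : IsOMinimal L N) : LocallyOMinimal L N where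
  exists_isLUB X hX hne hb := by
    obtain ⟨F, hF, hF', rfl⟩ := hN X hX
    exact exists_isLUB_sUnion hF hF' hne hb
  right X hX g z hgz := by
    obtain ⟨F, hF, hF', rfl⟩ := hN X hX
    exact sUnion_right hF hF' hgz

/-- For each formula both conditions are first-order in its finitely many parameters, so they can be
universally quantified and transferred as sentences. -/
theorem LocallyOMinimal.transfer [L.IsOrdered] {N : Type w'} [LinearOrder N]
    [L.Structure N] [L.OrderedStructure N] (hN : LocallyOMinimal L N) {M : Type w} [LinearOrder M]
    [L.Structure M] [L.OrderedStructure M] (hNM : N ≅[L] M) : LocallyOMinimal L M := by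
  have key : ∀ X : Set M, (Set.univ : Set M).Definable₁ L X →
      ∃ (A : Finset M) (φ : L.Formula (A ⊕ Unit)),
        X = {x | φ.Realize (Sum.elim Subtype.val fun _ => x)} := by
    intro X hX
    obtain ⟨A, -, hA⟩ := Set.definable_iff_finitely_definable.1 hX
    have hA' : (Set.range (Subtype.val : A → M)).Definable₁ L X := by
      have : Set.range (Subtype.val : A → M) = (A : Set M) := by simp
      rw [this]
      exact hA
    obtain ⟨φ, hφ⟩ := definable₁_range_iff.1 hA'
    exact ⟨A, φ, Set.ext hφ⟩
  have hdef : ∀ {ι : Type w} (φ : L.Formula (ι ⊕ Unit)) (a : ι → N),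
      (Set.univ : Set N).Definable₁ L {x | φ.Realize (Sum.elim a fun _ => x)} := fun φ a =>
    definable₁_univ (definable₁_range_iff.2 ⟨φ, fun x => Iff.rfl⟩)
  have hcorr : ∀ {ι β : Type w} (φ : L.Formula (ι ⊕ Unit)) (e : ι → β) (j : β),
      Corr L (fun v : β → N => v j ∈ {x | φ.Realize (Sum.elim (fun i => v (e i)) fun _ => x)})
        (fun v : β → M => v j ∈ {x | φ.Realize (Sum.elim (fun i => v (e i)) fun _ => x)}) := by
    intro ι β φ e j
    refine ⟨φ.relabel (Sum.elim e fun _ => j), fun v => ?_, fun v => ?_⟩ <;>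
    · rw [Formula.realize_relabel, Sum.comp_elim]
      rfl
  constructor
  · intro X hX hne hb
    obtain ⟨A, φ, rfl⟩ := key X hX
    have : Corr L (α := A)
        (fun v : A → N => (∃ x, x ∈ {x | φ.Realize (Sum.elim v fun _ => x)}) →
          (∃ b, ∀ x, x ∈ {x | φ.Realize (Sum.elim v fun _ => x)} → x ≤ b) →
          ∃ s, (∀ x, x ∈ {x | φ.Realize (Sum.elim v fun _ => x)} → x ≤ s) ∧
            ∀ b, (∀ x, x ∈ {x | φ.Realize (Sum.elim v fun _ => x)} → x ≤ b) → s ≤ b)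
        (fun v : A → M => (∃ x, x ∈ {x | φ.Realize (Sum.elim v fun _ => x)}) →
          (∃ b, ∀ x, x ∈ {x | φ.Realize (Sum.elim v fun _ => x)} → x ≤ b) →
          ∃ s, (∀ x, x ∈ {x | φ.Realize (Sum.elim v fun _ => x)} → x ≤ s) ∧
            ∀ b, (∀ x, x ∈ {x | φ.Realize (Sum.elim v fun _ => x)} → x ≤ b) → s ≤ b) := by
      refine Corr.imp (Corr.ex (hcorr φ _ _)) (Corr.imp (Corr.ex (Corr.all (Corr.imp (hcorr φ _ _)
        (Corr.le _ _)))) (Corr.ex (Corr.and (Corr.all (Corr.imp (hcorr φ _ _) (Corr.le _ _)))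
        (Corr.all (Corr.imp (Corr.all (Corr.imp (hcorr φ _ _) (Corr.le _ _))) (Corr.le _ _))))))
    obtain ⟨s, hs, hs'⟩ := this.transfer hNM (fun v hne hb => by
      obtain ⟨b, hb⟩ := hb
      obtain ⟨s, hs⟩ := hN.exists_isLUB _ (hdef φ v) hne ⟨b, fun x hx => hb x hx⟩
      exact ⟨s, fun x hx => hs.1 hx, fun b hb => hs.2 fun x hx => hb x hx⟩) Subtype.val hne (by
      obtain ⟨b, hb⟩ := hb
      exact ⟨b, fun x hx => hb hx⟩)
    exact ⟨s, fun x hx => hs x hx, fun b hb => hs' b fun x hx => hb hx⟩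
  · intro X hX g z hgz
    obtain ⟨A, φ, rfl⟩ := key X hX
    have : Corr L (α := A)
        (fun v : A → N => ∀ g, ∀ z, g < z → ∃ y, g < y ∧
          ((∀ t, g < t ∧ t < y → t ∈ {x | φ.Realize (Sum.elim v fun _ => x)}) ∨
            ∀ t, g < t ∧ t < y → ¬ t ∈ {x | φ.Realize (Sum.elim v fun _ => x)}))
        (fun v : A → M => ∀ g, ∀ z, g < z → ∃ y, g < y ∧
          ((∀ t, g < t ∧ t < y → t ∈ {x | φ.Realize (Sum.elim v fun _ => x)}) ∨
            ∀ t, g < t ∧ t < y → ¬ t ∈ {x | φ.Realize (Sum.elim v fun _ => x)})) := by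
      refine Corr.all (Corr.all (Corr.imp (Corr.lt _ _) (Corr.ex (Corr.and (Corr.lt _ _)
        (Corr.or (Corr.all (Corr.imp (Corr.and (Corr.lt _ _) (Corr.lt _ _)) (hcorr φ _ _)))
        (Corr.all (Corr.imp (Corr.and (Corr.lt _ _) (Corr.lt _ _)) (hcorr φ _ _).not)))))))
    exact this.transfer hNM (fun v g z hgz => hN.right _ (hdef φ v) g z hgz) Subtype.val g z hgz

end OMinimalStructures

/-! ### Saturation for definable sets, and complete types. -/

section Saturation

variable {L : FirstOrder.Language.{u, v}} {M : Type w} [L.Structure M]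

theorem definable₁_setOf_realize {B : Set M} (φ : L[[B]].Formula (Fin 1)) :
    B.Definable₁ L {x | φ.Realize fun _ => x} := by
  refine ⟨φ, ?_⟩
  ext x
  have : (fun _ => x 0) = x := by
    funext i
    rw [Subsingleton.elim i 0]
  simp [this]

theorem exists_formula_of_definable₁ {B : Set M} {X : Set M} (h : B.Definable₁ L X) :
    ∃ φ : L[[B]].Formula (Fin 1), X = {x | φ.Realize fun _ => x} := by
  obtain ⟨φ, hφ⟩ := h
  exact ⟨φ, Set.ext fun x => Set.ext_iff.1 hφ fun _ => x⟩

/-- Stated with definable sets, saturation passes to reducts at once; no `L`-type has to be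
completed to an `L'`-type. -/
theorem smallSaturated_of_expansion {L' : FirstOrder.Language.{u, v}} [L'.Structure M]
    (φ : L →ᴸ L') [φ.IsExpansionOn M] (h : SmallSaturated L' M) : SmallSaturated L M :=
  fun B hB Γ hΓ => h B hB Γ fun X hX => Set.Definable.map_expansion (hΓ X hX) φ

variable [Nonempty M]

theorem mem_typeOf_iff {B : Set M} {a : M} {σ : L[[B]][[Fin 1]].Sentence} :
    σ ∈ (L[[B]].completeTheory M).typeOf (fun _ : Fin 1 => a) ↔
      a ∈ {x : M | (Formula.equivSentence.symm σ).Realize fun _ : Fin 1 => x} :=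
  Theory.CompleteType.mem_typeOf

theorem IsMonster.smallSaturated (h : IsMonster L M) : SmallSaturated L M := by
  intro B hB Γ hΓ hfip
  let S : L[[B]][[Fin 1]].Theory :=
    {σ | {x : M | (Formula.equivSentence.symm σ).Realize fun _ : Fin 1 => x} ∈ Γ}
  have hsat : ((L[[B]].lhomWithConstants (Fin 1)).onTheory (L[[B]].completeTheory M) ∪
      S).IsSatisfiable := by
    rw [Theory.isSatisfiable_iff_isFinitelySatisfiable]
    intro T₀ hT₀
    let F : Set (Set M) :=
      (fun σ => {x : M | (Formula.equivSentence.symm σ).Realize fun _ : Fin 1 => x}) '' (T₀ ∩ S)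
    obtain ⟨x, hx⟩ := hfip F (by
      rintro _ ⟨σ, hσ, rfl⟩
      exact hσ.2) ((T₀.finite_toSet.inter_of_left S).image _)
    let p := (L[[B]].completeTheory M).typeOf (fun _ : Fin 1 => x)
    -- Finite satisfiability is witnessed by the type of a point common to the finitely many sets
    -- involved.
    refine p.isMaximal.1.mono fun σ hσ => ?_
    rcases hT₀ hσ with h | h
    · exact p.subset h
    · exact mem_typeOf_iff.2 (hx _ ⟨σ, ⟨hσ, h⟩, rfl⟩)
  obtain ⟨p, hp⟩ : {p : TypesOver L B | S ⊆ ↑p}.Nonempty := by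
    rw [Set.nonempty_iff_ne_empty]
    exact fun h => (Theory.CompleteType.setOfPred_subset_eq_empty_iff S).1 h hsat
  obtain ⟨a, ha⟩ := h.saturated B hB p
  refine ⟨a, fun X hX => ?_⟩
  obtain ⟨φ, rfl⟩ := exists_formula_of_definable₁ (hΓ X hX)
  have hmem : Formula.equivSentence φ ∈ p := hp (by simpa [S] using hX)
  rw [← ha, mem_typeOf_iff] at hmem
  simpa using hmem

theorem realizes_of_forall {B : Set M} {p : TypesOver L B} {a : M}
    (h : ∀ σ ∈ p, a ∈ {x : M | (Formula.equivSentence.symm σ).Realize fun _ : Fin 1 => x}) :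
    Realizes a p := by
  -- Inclusion of one complete type in another is equality: a sentence missing from `p` has its
  -- negation in `p`.
  refine SetLike.ext fun σ => ⟨fun hσ => ?_, fun hσ => mem_typeOf_iff.2 (h σ hσ)⟩
  by_contra hσ'
  rw [← Theory.CompleteType.not_mem_iff] at hσ'
  have := mem_typeOf_iff.2 (h _ hσ')
  rw [Theory.CompleteType.not_mem_iff] at this
  exact this hσ

theorem Realizes.of_typeEq {B : Set M} {p : TypesOver L B} {a b : M} (ha : Realizes a p)
    (hab : TypeEq L B a b) : Realizes b p :=
  realizes_of_forall fun σ hσ => by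
    rw [← ha, mem_typeOf_iff] at hσ
    exact (hab _ (definable₁_setOf_realize _)).1 hσ

theorem NonAlgebraic.not_mem_dcl {B : Set M} {p : TypesOver L B} (hp : NonAlgebraic p) {a : M}
    (ha : Realizes a p) : a ∉ dcl L B := by
  intro hmem
  obtain ⟨φ, hφ⟩ := exists_formula_of_definable₁ hmem
  refine hp φ ?_ (hφ ▸ Set.finite_singleton a)
  rw [← ha, mem_typeOf_iff, Equiv.symm_apply_apply, ← hφ]
  rfl

theorem SmallSaturated.exists_realizes (hS : SmallSaturated L M) {B : Set M} (hB : #B < #M)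
    {p : TypesOver L B} (hp : NonAlgebraic p) : ∃ a, Realizes a p := by
  let S : L[[B]][[Fin 1]].Sentence → Set M := fun σ =>
    {x : M | (Formula.equivSentence.symm σ).Realize fun _ : Fin 1 => x}
  obtain ⟨a, ha⟩ := hS B hB {X | ∃ σ ∈ p, X = S σ} (by
    rintro _ ⟨σ, -, rfl⟩
    exact definable₁_setOf_realize _) (by
    intro F hF hfin
    obtain ⟨σ, hσ, h⟩ : ∃ σ ∈ p, ⋂₀ F = S σ := by
      induction F, hfin using Set.Finite.induction_on with
      | empty =>
        refine ⟨⊤, p.mem_of_models fun _ _ _ h => h, ?_⟩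
        ext x
        simp only [S, Set.sInter_empty, Set.mem_univ, true_iff, Set.mem_ofPred_eq]
        rw [Formula.realize_equivSentence_symm]
        exact id
      | @insert X F hX _ ih =>
        obtain ⟨σ, hσ, rfl⟩ := hF (Set.mem_insert _ F)
        obtain ⟨τ, hτ, h⟩ := ih ((Set.subset_insert _ F).trans hF)
        refine ⟨σ ⊓ τ, ?_, ?_⟩
        · have h1 := (p.isMaximal.mem_iff_models σ).1 hσ
          have h2 := (p.isMaximal.mem_iff_models τ).1 hτ
          exact (p.isMaximal.mem_iff_models (σ ⊓ τ)).2 fun W v xs =>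
            BoundedFormula.realize_inf.2 ⟨h1 W v xs, h2 W v xs⟩
        · rw [Set.sInter_insert, h]
          ext x
          simp only [S, Set.mem_inter_iff, Set.mem_ofPred_eq]
          rw [Formula.realize_equivSentence_symm, Formula.realize_equivSentence_symm,
            Formula.realize_equivSentence_symm]
          let : (constantsOn (Fin 1)).Structure M := constantsOn.structure fun _ => x
          exact BoundedFormula.realize_inf.symm
    rw [h]
    refine (hp (Formula.equivSentence.symm σ) ?_).nonempty
    rwa [Equiv.apply_symm_apply])
  exact ⟨a, realizes_of_forall fun σ hσ => ha _ ⟨σ, hσ, rfl⟩⟩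

end Saturation

/-! ### What the axioms of `Tindep` say about intervals and definable closure. -/

section Axioms

variable {L : FirstOrder.Language.{u, v}} {M : Type w} [L.Structure M]

theorem realize_up {H : Set M} {α : Type} {φ : L.Formula α} {v : α → M} :
    Formula.Realize (M := Expansion M H) (up φ) v ↔ φ.Realize v :=
  LHom.realize_onFormula (M := Expansion M H) LHom.sumInl φ

theorem realize_inH {H : Set M} {α : Type} {x : α} {v : α → M} :
    Formula.Realize (M := Expansion M H) (inH x : (withH L).Formula α) v ↔ v x ∈ H := by
  refine (Formula.realize_rel₁ (M := Expansion M H)).trans ?_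
  exact Iff.rfl

theorem realize_univClosure {α : Type} [Finite α] {φ : L.Formula α} :
    M ⊨ univClosure φ ↔ ∀ v : α → M, φ.Realize v := by
  simp [univClosure, Sentence.Realize, Formula.realize_iAlls, Formula.realize_relabel]

theorem realize_atLeast {α : Type} {n : ℕ} {φ : L.Formula (α ⊕ Unit)} {v : α → M} :
    (atLeast n φ).Realize v ↔
      ∃ g : Fin n → M, (∀ i, φ.Realize (Sum.elim v fun _ => g i)) ∧ Function.Injective g := by
  simp only [atLeast, Formula.realize_iExs, Formula.realize_inf, Formula.realize_iInf,
    Formula.realize_relabel, Formula.realize_not, Formula.realize_equal, Term.realize_var,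
    Sum.elim_inr]
  refine exists_congr fun g => and_congr (forall_congr' fun i => ?_) ⟨fun h i j hij => ?_,
    fun h ij hg => ij.2 (h hg)⟩
  · apply iff_of_eq
    congr 1
    funext x
    rcases x with x | x <;> rfl
  · by_contra hne
    exact h ⟨(i, j), hne⟩ hij

theorem independence_of_models {T : L.Theory} {H : Set M} (hH : Expansion M H ⊨ Tindep T) {n : ℕ}
    {a : Fin n → M} (ha : ∀ i, a i ∈ H) {h : M} (hh : h ∈ H) (hd : h ∈ dcl L (Set.range a)) :
    ∃ i, h = a i := by
  by_contra! hne
  obtain ⟨ψ, hψ⟩ := definable₁_range_iff.1 hd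
  -- The bound `2` says "at most one solution", as befits a formula that defines the single element
  -- `h`.
  have hax := hH.realize_of_mem (independenceAxiom n 2 ψ)
    (Or.inl (Or.inl (Or.inr ⟨n, 2, ψ, rfl⟩)))
  rw [independenceAxiom, realize_univClosure] at hax
  have h := hax (Sum.elim a fun _ => h)
  simp only [Formula.realize_imp, Formula.realize_inf, Formula.realize_iInf, Formula.realize_not,
    Formula.realize_relabel, Formula.realize_equal, Term.realize_var] at h
  have hfew : (fewerThan 2 ψ).Realize a := by
    rw [fewerThan, Formula.realize_not, realize_atLeast]
    rintro ⟨g, hg, hinj⟩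
    have h0 : ∀ i, g i = _ := fun i => (hψ (g i)).2 (hg i)
    exact absurd (hinj ((h0 0).trans (h0 1).symm)) (by decide)
  exact h ⟨⟨⟨fun i => realize_inH.2 (ha i), realize_inH.2 hh⟩, fun i => hne i⟩, realize_up.2 hfew⟩
    (realize_up.2 ((hψ _).1 rfl))

variable [LinearOrder M]

/-- The formula `y₀ < x ∧ x < y₁`. -/
def betweenFormula (L : FirstOrder.Language.{u, v}) [L.IsOrdered] : L.Formula (Fin 2 ⊕ Unit) :=
  ∼(Relations.formula₂ leSymb (Term.var (Sum.inr ())) (Term.var (Sum.inl 0))) ⊓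
    ∼(Relations.formula₂ leSymb (Term.var (Sum.inl 1)) (Term.var (Sum.inr ())))

variable [L.IsOrdered] [L.OrderedStructure M]

theorem realize_betweenFormula {v : Fin 2 → M} {x : M} :
    (betweenFormula L).Realize (Sum.elim v fun _ => x) ↔ v 0 < x ∧ x < v 1 := by
  rw [betweenFormula, Formula.realize_inf, Formula.realize_not, Formula.realize_not,
    Formula.realize_rel₂, Formula.realize_rel₂, relMap_leSymb, relMap_leSymb]
  simp

variable [DenselyOrdered M]

theorem realize_atLeast_betweenFormula {v : Fin 2 → M} (hv : v 0 < v 1) (n : ℕ) :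
    (atLeast n (betweenFormula L)).Realize v := by
  rw [realize_atLeast]
  let e := (Set.Ioo_infinite hv).natEmbedding
  refine ⟨fun i => (e i).1, fun i => realize_betweenFormula.2 (e i).2, fun i j hij => ?_⟩
  exact Fin.ext (e.injective (Subtype.ext hij))

/-- `N = 1` suffices: in a dense order an interval with one point is infinite. -/
theorem eliminates_betweenFormula [Nonempty M] {T : L.Theory} (hT : T.IsComplete) (hM : M ⊨ T) :
    Eliminates T 1 (betweenFormula L) := by
  intro m
  rw [Theory.models_formula_iff]
  intro W v
  have hMW : M ≅[L] W := hT.models_elementarily_equivalent M W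
  let χ := (atLeast 1 (betweenFormula L)).imp (atLeast m (betweenFormula L))
  have hχ : Corr L (fun v : Fin 2 → M => χ.Realize v) (fun v : Fin 2 → W => χ.Realize v) :=
    ⟨χ, fun _ => Iff.rfl, fun _ => Iff.rfl⟩
  refine hχ.transfer hMW (fun v => ?_) v
  rw [Formula.realize_imp]
  intro h
  obtain ⟨g, hg, -⟩ := realize_atLeast.1 h
  have := realize_betweenFormula.1 (hg 0)
  exact realize_atLeast_betweenFormula (this.1.trans this.2) m

theorem denseIndependent_of_models [Nonempty M] {T : L.Theory} (hT : T.IsComplete) (hM : M ⊨ T)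
    {k : ℕ} {f : Fin k → M → M} (hf : ∀ i, ZeroDefinable L (f i)) {H : Set M}
    (hH : Expansion M H ⊨ Tindep T) : DenseIndependent L f H where
  not_mem_dcl h hh hd := by
    have : Set.range (Fin.elim0 : Fin 0 → M) = ∅ := Set.range_eq_empty _
    obtain ⟨i, -⟩ := independence_of_models hH (a := Fin.elim0) (fun i => i.elim0) hh (this ▸ hd)
    exact i.elim0
  eq_of_mem_dcl h hh h' hh' hd := by
    have : Set.range (fun _ : Fin 1 => h') = {h'} := Set.range_const
    obtain ⟨i, hi⟩ := independence_of_models hH (a := fun _ : Fin 1 => h') (fun i => hh') hh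
      (this ▸ hd)
    exact hi
  dense lo hi hlt := by
    have hax := hH.realize_of_mem (densityAxiom 2 1 (betweenFormula L))
      (Or.inl (Or.inr ⟨2, 1, _, eliminates_betweenFormula hT hM, rfl⟩))
    rw [densityAxiom, realize_univClosure] at hax
    have h := hax ![lo, hi]
    simp only [Formula.realize_imp, Formula.realize_inf, Formula.realize_iExs] at h
    have hlt' : (![lo, hi] : Fin 2 → M) 0 < ![lo, hi] 1 := hlt
    obtain ⟨x, hx, hx'⟩ := h (realize_up.2 (realize_atLeast_betweenFormula hlt' 1))
    exact ⟨x (), (realize_inH (x := Sum.inr ()) (v := Sum.elim ![lo, hi] x)).1 hx,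
      (realize_betweenFormula (v := ![lo, hi]) (x := x ())).1 (realize_up.1 hx')⟩
  extension lo hi hlt := by
    choose φ hφ using fun i => Set.empty_definable_iff.1 (hf i)
    have hφ' : ∀ i (v : Fin 2 → M), (φ i).Realize v ↔ f i (v 0) = v 1 := fun i v =>
      (Set.ext_iff.1 (hφ i) v).symm
    -- The formula `x = fᵢ(y)` for some `i`. For given `y` it has at most `k` solutions, whence the
    -- bound `k + 1`.
    let ψ : L.Formula ((Fin 2 ⊕ Fin 1) ⊕ Unit) := ∼(Formula.iInf fun i : Fin k =>
      ∼((φ i).relabel ![Sum.inl (Sum.inr 0), Sum.inr ()]))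
    have hψ : ∀ v : (Fin 2 ⊕ Fin 1) ⊕ Unit → M, ψ.Realize v ↔
        ∃ i, f i (v (Sum.inl (Sum.inr 0))) = v (Sum.inr ()) := by
      intro v
      simp [ψ, hφ']
    have hfew : (Formula.iAlls (Fin 1) (fewerThan (k + 1) ψ)).Realize ![lo, hi] := by
      rw [Formula.realize_iAlls]
      intro y
      rw [fewerThan, Formula.realize_not, realize_atLeast]
      rintro ⟨g, hg, hinj⟩
      choose j hj using fun i => (hψ _).1 (hg i)
      obtain ⟨i, i', hne, heq⟩ := Fintype.exists_ne_map_eq_of_card_lt j (by simp)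
      refine hne (hinj ?_)
      have h1 := hj i
      have h2 := hj i'
      simp only [Sum.elim_inl, Sum.elim_inr] at h1 h2
      rw [← h1, ← h2, heq]
    have hlt' : (![lo, hi] : Fin 2 → M) 0 < ![lo, hi] 1 := hlt
    have hax := hH.realize_of_mem (extensionAxiom 2 1 (k + 1) 1 (betweenFormula L) ψ)
      (Or.inr ⟨2, 1, k + 1, 1, _, ψ, eliminates_betweenFormula hT hM, rfl⟩)
    rw [extensionAxiom, realize_univClosure] at hax
    have h := hax ![lo, hi]
    simp only [Formula.realize_imp, Formula.realize_inf, Formula.realize_iExs,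
      Formula.realize_iAlls, Formula.realize_iInf, Formula.realize_not,
      Formula.realize_relabel] at h
    obtain ⟨x, hx, hx'⟩ :=
      h ⟨realize_up.2 hfew, realize_up.2 (realize_atLeast_betweenFormula hlt' 1)⟩
    refine ⟨x (), (realize_betweenFormula (v := ![lo, hi]) (x := x ())).1 (realize_up.1 hx),
      fun i y hy hfy => ?_⟩
    exact hx' (fun _ => y) (fun _ => realize_inH.2 hy) (realize_up.2 ((hψ _).2 ⟨i, hfy⟩))

end Axioms

/-! ### Density and extension over small sets, and the conclusion. -/

section Main

variable {L : FirstOrder.Language.{u, v}} {M : Type w} [L.Structure M]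

theorem model_of_expansion {T : L.Theory} {H : Set M} (hH : Expansion M H ⊨ Tindep T) : M ⊨ T := by
  have h : Expansion M H ⊨ (LHom.sumInl : L →ᴸ withH L).onTheory T :=
    hH.mono fun _ hσ => Or.inl (Or.inl (Or.inl hσ))
  exact (LHom.onTheory_model (M := Expansion M H) LHom.sumInl T).1 h

/-- An automorphism that maps `H` onto `H'` is an isomorphism of the expansions. -/
def expansionEquiv {H H' : Set M} (e : M ≃[L] M) (he : ∀ c, c ∈ H ↔ e c ∈ H') :
    Expansion M H ≃[withH L] Expansion M H' where
  toEquiv := e.toEquiv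
  map_fun' := fun {n} F x => by
    rcases F with F | F
    · exact e.map_fun' F x
    · exact nomatch F
  map_rel' := fun {n} r x => by
    rcases r with r | r
    · exact e.map_rel' r x
    · cases r
      exact (he _).symm

variable [Nonempty M] [LinearOrder M] [L.IsOrdered] [L.OrderedStructure M] [DenselyOrdered M]
  {k : ℕ} {f : Fin k → M → M} {H : Set M}

theorem TrivialMonster.densityOverSmall (hM : TrivialMonster L M f)
    (hH : DenseIndependent L f H) : DensityOverSmall L H := by
  intro B hB p hp
  obtain ⟨c, hc⟩ := hM.saturated.exists_realizes hB hp
  obtain ⟨h, hh, hch⟩ := hM.exists_typeEq_mem hH hB (hp.not_mem_dcl hc)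
  exact ⟨h, hh, hc.of_typeEq hch⟩

theorem TrivialMonster.extensionOverSmall (hM : TrivialMonster L M f)
    (hH : DenseIndependent L f H) : ExtensionOverSmall L H := by
  intro B hB p hp
  obtain ⟨c, hc⟩ := hM.saturated.exists_realizes hB hp
  obtain ⟨e, hce, he⟩ := hM.exists_typeEq_not_mem_dcl hH hB (hp.not_mem_dcl hc)
  exact ⟨e, hc.of_typeEq hce, by rwa [acl_eq_dcl]⟩

end Main

end OrbitElem

theorem proposition4p3 {L : FirstOrder.Language.{u, v}} [L.IsOrdered]
    -- `T` is the complete theory of a densely ordered o-minimal structure `N`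
    (T : L.Theory) (hT : T.IsComplete)
    (N : Type w') [Infinite N] [LinearOrder N] [DenselyOrdered N] [L.Structure N]
    [L.OrderedStructure N] (hNT : N ⊨ T) (hN : OrbitElem.IsOMinimal L N)
    -- `(C, H)` is the monster model of `T^indep`
    (C : Type w) [Nonempty C] [L.Structure C] (H : Set C)
    (hCH : OrbitElem.Expansion C H ⊨ OrbitElem.Tindep T)
    (hmonster : OrbitElem.IsMonster (OrbitElem.withH L) (OrbitElem.Expansion C H))
    (k : ℕ) (f : Fin k → C → C) (hf : ∀ i, OrbitElem.ZeroDefinable L (f i))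
    (hdcl : ∀ A : Set C,
      OrbitElem.dcl L A = (⋃ i, f i '' A) ∪ OrbitElem.dcl L (∅ : Set C)) :
    OrbitElem.orbit L H = OrbitElem.elemClass L H ∧
      ∀ H' : Set C,
        (OrbitElem.Expansion C H ≅[OrbitElem.withH L] OrbitElem.Expansion C H') →
          OrbitElem.DensityOverSmall L H' ∧ OrbitElem.ExtensionOverSmall L H' ∧
            Nonempty (OrbitElem.Expansion C H ≃[OrbitElem.withH L] OrbitElem.Expansion C H') := by
  classical
  have hC : C ⊨ T := OrbitElem.model_of_expansion hCH
  have hNC : N ≅[L] C := hT.models_elementarily_equivalent N C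
  have : C ⊨ L.linearOrderTheory :=
    ⟨fun σ hσ => (hNC.realize_sentence σ).1 (Theory.realize_sentence_of_mem L.linearOrderTheory hσ)⟩
  -- The order on `C` is read off the order symbol, as `C` is elementarily equivalent to `N`.
  let := L.linearOrderOfModels C
  have : L.OrderedStructure C := inferInstance
  have : DenselyOrdered C := (realize_denselyOrdered_iff (L := L)).1
    ((hNC.realize_sentence _).1 (realize_denselyOrdered_iff.2 inferInstance))
  have hS : OrbitElem.SmallSaturated L (OrbitElem.Expansion C H) :=
    OrbitElem.smallSaturated_of_expansion LHom.sumInl hmonster.smallSaturated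
  have hM : OrbitElem.TrivialMonster L C f :=
    { locallyOMinimal := hN.locallyOMinimal.transfer hNC
      saturated := hS
      aleph0_lt := hmonster.inaccessible.aleph0_lt
      zeroDefinable := hf
      dcl_eq := hdcl }
  have hH := OrbitElem.denseIndependent_of_models hT hC hf hCH
  have key : ∀ H' : Set C,
      (OrbitElem.Expansion C H ≅[OrbitElem.withH L] OrbitElem.Expansion C H') →
        OrbitElem.DensityOverSmall L H' ∧ OrbitElem.ExtensionOverSmall L H' ∧
          Nonempty (OrbitElem.Expansion C H ≃[OrbitElem.withH L] OrbitElem.Expansion C H') := by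
    intro H' hHH'
    -- Only the axioms are carried over to `H'`; the saturation used is that of the `L`-structure
    -- `C`, which does not involve `H'`.
    have hCH' : OrbitElem.Expansion C H' ⊨ OrbitElem.Tindep T := hHH'.theory_model
    have hH' := OrbitElem.denseIndependent_of_models hT hC hf hCH'
    obtain ⟨e, he⟩ := hM.exists_equiv hmonster.inaccessible.isRegular hH hH'
    exact ⟨hM.densityOverSmall hH', hM.extensionOverSmall hH', ⟨OrbitElem.expansionEquiv e he⟩⟩
  refine ⟨Set.Subset.antisymm ?_ fun H' hH' => (key H' hH').2.2, key⟩
  rintro H' ⟨e⟩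
  exact elementarilyEquivalent_iff.2 fun σ => StrongHomClass.realize_sentence e σ
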